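/- **Setting.** A finite simple graph $G$ without isolated nodes is a $D(\delta)$ graph, $\delta=[D(1),D(2),\dots]$, if $G$ has exactly $D(j)$ nodes of degree $j$ for every $j\ge 1$. For $L\ge 1$, the distribution $\delta$ with $n=\sum_j D(j)$ follows a power law with constant $L$ if for all $j\ge 1$ we have $D(j)\le L\,n/j^2$, and $D(j)\ge n/(Lj^2)$ whenever $n/(Lj^2)\ge 1$. A $D(\delta)$ graph with $m$ edges is concentrated, with community $S$ and constant $A$, if $S$ is a nonempty set of nodes, $|S|\le A\sqrt{m/2}$, every node of $S$ has degree at least that of every node outside $S$, and every node of $S$ has at least half of its neighbours in $S$. A $D(\delta)^2$ graph $G=G_1\mid G_2$ following a power law (with constants $L,A,B$) is the disjoint union of two concentrated graphs $G_1=(V_1,E_1)$, $G_2=(V_2,E_2)$ with $m$ edges each, with the same power-law degree distribution $\delta$ and with communities $S_1,S_2$, together with at most $B$ further edges between nodes of $V_1\setminus S_1$ and nodes of $V_2\setminus S_2$. So $G$ has $2m$ edges besides these joining edges. **Algorithm.** The edges of $G$ arrive as a stream, in an arbitrary order and without repetition. The DC-algorithm with parameters $k,c,h$ maintains a uniform $k$-reservoir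 $\widehat R$: the first $k$ edges are taken; for $j>k$ the $j$-th edge is selected with probability $k/j$, and then replaces a uniformly random edge of the reservoir. It stores the nodes seen. After every $c$ edges, and when the stream stops, it updates its list of large connected components of the graph formed by $\widehat R$, i.e. those with at least $h$ nodes. A reported component $\widehat C$ detects $S_i$ if there are at least $h$ nodes in $\widehat C\cap S_i$ that are connected to each other by edges of $\widehat R$ inside $S_i$. **Theorem.** For all constants $L\ge 1$, $A$, $B$ and every $h$ there is an $m_0$ such that for every $a>0$ there is a constant $\delta_0>0$ with the following property. Let $G=G_1\mid G_2$ be a $D(\delta)^2$ graph following a power law with constants $L,A,B$, where $G_1$ and $G_2$ have $m\ge m_0$ edges each. Let $k\ge 2(h-1)$ be such that $k\ge a\sqrt m$, and let $c$ be any update period. Then, for every stream of the edges of $G$, with probability at least $\delta_0$ the components reported by the DC-algorithm when the stream stops include a component $\widehat C_1$ that detects $S_1$ and a component $\widehat C_2$ that detects $S_2$. If moreover $k\le m$, then with probability at least $\delta_0$ such components exist with $\widehat C_1\subseteq V_1$ and $\widehat C_2\subseteq V_2$ (so they are distinct). (For a given graph and given $k$ one may take $a=k/\sqrt m$; so for every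 $D(\delta)^2$ graph with $m\ge m_0$ and every $k\ge\max(1,2(h-1))$ there is such a constant. It depends only on $L,A,B,h$ and on a lower bound for $k/\sqrt m$.) -/

import Mathlib

noncomputable section

/-! ### Power laws, `D(δ)` graphs and their communities -/

/-- `G` has the degree distribution `[D 1, D 2, …]`: exactly `D j` nodes have degree `j`, for
every `j`, and there is no node of degree `0`. -/
def HasDegreeDistribution {V : Type*} (G : SimpleGraph V) (D : ℕ → ℕ) : Prop :=
  D 0 = 0 ∧ ∀ j : ℕ, {v : V | (G.neighborSet v).ncard = j}.ncard = D j

/-- The degree counts `D` of a graph with `n` nodes follow the power law `D j / n ≈ c / j ^ 2`,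
up to a constant factor `L` (which absorbs `c`). As the `D j` are integers, the lower bound is
required only for those `j` at which it is at least `1`. -/
def IsPowerLaw (L : ℝ) (n : ℕ) (D : ℕ → ℕ) : Prop :=
  ∀ j : ℕ, 1 ≤ j →
    (D j : ℝ) ≤ L * n / (j : ℝ) ^ 2 ∧
      (L * (j : ℝ) ^ 2 ≤ n → (n : ℝ) / (L * (j : ℝ) ^ 2) ≤ D j)

/-- `S` is a community of the graph `G` with `m` edges, i.e. `S` witnesses that `G` is
concentrated: `S` is a nonempty set of at most `A * √(m / 2)` nodes, it consists of nodes of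
highest degree, and each node of `S` has at least half of its neighbours in `S`. -/
structure IsCommunity {V : Type*} (A : ℝ) (G : SimpleGraph V) (S : Set V) : Prop where
  nonempty : S.Nonempty
  card_le : (S.ncard : ℝ) ≤ A * √((G.edgeSet.ncard : ℝ) / 2)
  highest : ∀ u ∈ S, ∀ v ∉ S, (G.neighborSet v).ncard ≤ (G.neighborSet u).ncard
  dense : ∀ u ∈ S, (G.neighborSet u).ncard ≤ 2 * (G.neighborSet u ∩ S).ncard

/-- The union of `G₁` and `G₂` (on disjoint node sets) with the joining edges
`{u, v}`, `(u, v) ∈ F`. -/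
def joinGraph {V₁ V₂ : Type*} (G₁ : SimpleGraph V₁) (G₂ : SimpleGraph V₂)
    (F : Finset (V₁ × V₂)) : SimpleGraph (V₁ ⊕ V₂) :=
  (G₁ ⊕g G₂) ⊔ SimpleGraph.fromEdgeSet {e | ∃ p ∈ F, e = s(Sum.inl p.1, Sum.inr p.2)}

/-- `joinGraph G₁ G₂ F` is a `D(δ)²` graph with the communities `S₁` and `S₂`: `G₁` and `G₂` are
concentrated graphs with the same power-law degree distribution `D`, and at most `B` further edges
join them, with endpoints of low degree, i.e. outside the communities. -/
structure IsDSquared {V₁ V₂ : Type*} (L A : ℝ) (B : ℕ) (D : ℕ → ℕ)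
    (G₁ : SimpleGraph V₁) (G₂ : SimpleGraph V₂) (F : Finset (V₁ × V₂))
    (S₁ : Set V₁) (S₂ : Set V₂) : Prop where
  dist₁ : HasDegreeDistribution G₁ D
  dist₂ : HasDegreeDistribution G₂ D
  powerLaw : IsPowerLaw L (Nat.card V₁) D
  community₁ : IsCommunity A G₁ S₁
  community₂ : IsCommunity A G₂ S₂
  few : F.card ≤ B
  low : ∀ p ∈ F, p.1 ∉ S₁ ∧ p.2 ∉ S₂

/-- `s` is a stream of the edges of `G`: an enumeration, in some order and without repetition. -/
def IsEdgeStream {V : Type*} (G : SimpleGraph V) (s : List (Sym2 V)) : Prop :=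
  s.Nodup ∧ ∀ e, e ∈ s ↔ e ∈ G.edgeSet

/-! ### Reservoir sampling and the community detection algorithm -/

open Classical in
/-- One step of uniform `k`-reservoir sampling: `t` elements have been read, `R` is the current
reservoir, and `e` is the next element. The first `k` elements enter the reservoir. A later one is
selected with probability `k / (t + 1)`, and then replaces a uniformly random element of `R`. -/
def reservoirStep {α : Type*} (k t : ℕ) (R : Finset α) (e : α) : PMF (Finset α) :=
  if t < k then PMF.pure (insert e R)
  else
    (PMF.uniformOfFintype (Fin (t + 1))).bind fun i =>
      if hR : (i : ℕ) < k ∧ R.Nonempty then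
        (PMF.uniformOfFinset R hR.2).map fun f => insert e (R.erase f)
      else PMF.pure R

/-- The random subgraph whose edges are those of the reservoir. -/
def reservoirGraph {V : Type*} (R : Finset (Sym2 V)) : SimpleGraph V :=
  SimpleGraph.fromEdgeSet (R : Set (Sym2 V))

/-- The large connected components (with at least `h` nodes) of the reservoir. -/
def largeComponents {V : Type*} (h : ℕ) (R : Finset (Sym2 V)) : Set (Set V) :=
  {C | (∃ c : (reservoirGraph R).ConnectedComponent, c.supp = C) ∧ h ≤ C.ncard}

/-- The memory of the algorithm: the number of edges read, the reservoir, the database of the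
nodes seen so far, and the large components at the last update. -/
structure DCState (V : Type*) where
  read : ℕ
  reservoir : Finset (Sym2 V)
  nodes : Set V
  comps : Set (Set V)

/-- The algorithm reads the edge `e`: it maintains the `k`-reservoir and the database of nodes,
and updates the large components after every `c` edges. -/
def dcStep {V : Type*} (k c h : ℕ) (st : DCState V) (e : Sym2 V) : PMF (DCState V) :=
  open Classical in
  (reservoirStep k st.read st.reservoir e).map fun R =>
    { read := st.read + 1
      reservoir := R
      nodes := st.nodes ∪ {v | v ∈ e}
      comps := if c ∣ st.read + 1 then largeComponents h R else st.comps }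

/-- Reading a stream edge by edge. When the stream stops, the large components of the reservoir
are stored. -/
def dcRun {V : Type*} (k c h : ℕ) : List (Sym2 V) → DCState V → PMF (DCState V)
  | [], st => PMF.pure { st with comps := largeComponents h st.reservoir }
  | e :: s, st => (dcStep k c h st e).bind (dcRun k c h s)

/-- The law of the final memory of the community detection algorithm with a reservoir of size `k`,
update period `c` and size threshold `h`, on the stream `s`. -/
def dcAlgorithm {V : Type*} (k c h : ℕ) (s : List (Sym2 V)) : PMF (DCState V) :=
  dcRun k c h s { read := 0, reservoir := ∅, nodes := ∅, comps := ∅ }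

/-- The reported component `C` detects `S`: at least `h` of its nodes lie in `S` and are connected
to each other by reservoir edges inside `S`. -/
def DetectsWith {V : Type*} (h : ℕ) (st : DCState V) (S C : Set V) : Prop :=
  C ∈ st.comps ∧
    ∃ T : Set V, T ⊆ C ∩ S ∧ h ≤ T.ncard ∧ ((reservoirGraph st.reservoir).induce T).Connected

/-- Both communities are detected. -/
def DetectsBoth {V₁ V₂ : Type*} (h : ℕ) (S₁ : Set V₁) (S₂ : Set V₂)
    (st : DCState (V₁ ⊕ V₂)) : Prop :=
  ∃ C₁ C₂ : Set (V₁ ⊕ V₂),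
    DetectsWith h st (Sum.inl '' S₁) C₁ ∧ DetectsWith h st (Sum.inr '' S₂) C₂

/-- Both communities are detected, by components contained in `V₁` and in `V₂` respectively;
these are in particular distinct. -/
def DetectsBothSeparately {V₁ V₂ : Type*} (h : ℕ) (S₁ : Set V₁) (S₂ : Set V₂)
    (st : DCState (V₁ ⊕ V₂)) : Prop :=
  ∃ C₁ C₂ : Set (V₁ ⊕ V₂),
    DetectsWith h st (Sum.inl '' S₁) C₁ ∧ DetectsWith h st (Sum.inr '' S₂) C₂ ∧
      C₁ ⊆ Set.range Sum.inl ∧ C₂ ⊆ Set.range Sum.inr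

end

/-! The power law forces every degree up to order `√n` to occur. As a community consists of nodes of
highest degree that keep half of their neighbours inside, it contains `r` of order `√n` stars with
`r` leaves each (`exists_isStarSystem`). A reservoir holding `h - 1` edges of one star in each
community detects both.

Summing the power law gives `m = O(n log n)`, so a reservoir of `k ≥ a√m` edges keeps an edge with
probability at least of order `1 / √m`. Cut the leaves of each star into `l = h - 1` parts of size
about `r / (l + 1)`. A part is hit with probability at least of order `1 / √(log n)`, all parts of
one star with probability at least of order `(log n) ^ (-l / 2)`. There are about `√n` stars, so
some star succeeds with high probability (`eventually_blocks_le`).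

That computation needs independence. A uniform `k`-subset is therefore compared with one colour
class of a random colouring with `M` colours: success is monotone, so classes of size at most `k` do
no better than `k`-subsets (`card_colouring_mul_choose_le`), and Markov's inequality makes larger
classes unlikely.

Reservoir sampling gives each `k`-subset at least the uniform probability
(`inv_choose_le_reservoirRun`). Avoiding the at most `B` joining edges costs a factor `2 ^ B` when
`k ≤ m`. Larger `k` follow from `k = m` by monotonicity. The finitely many `m` below a bound
depending on `a` only need one good set, which lets `m₀` be independent of `a`. -/

noncomputable section

/-! ### Uniform subsets compared with colour classes of random colourings -/

open Finset in
/-- In a finite set, the density of a monotone family among the `j`-subsets increases with `j`. -/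
theorem card_filter_powersetCard_mul_choose_le {α : Type*} (X : Finset α)
    (P : Finset α → Prop) [DecidablePred P] (hP : ∀ s t, s ⊆ t → P s → P t) {j k : ℕ}
    (hjk : j ≤ k) :
    #{T ∈ powersetCard j X | P T} * (#X).choose k ≤
      #{T ∈ powersetCard k X | P T} * (#X).choose j := by
  classical
  rcases lt_or_ge (#X) k with hk | hk
  · simp [Nat.choose_eq_zero_of_lt hk]
  have key : #{T ∈ powersetCard j X | P T} * (#X - j).choose (k - j) ≤
      #{T ∈ powersetCard k X | P T} * k.choose j := by
    -- Double counting of pairs `s ⊆ t`: all `(#X - j).choose (k - j)` supersets of a member `s` are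
    -- members, and `t` has only `k.choose j` subsets of size `j`.
    refine Finset.card_mul_le_card_mul (fun s t => s ⊆ t) ?_ ?_
    · intro s hs
      rw [mem_filter, mem_powersetCard] at hs
      obtain ⟨⟨hsX, hsj⟩, hsP⟩ := hs
      have : #(powersetCard (k - j) (X \ s)) = (#X - j).choose (k - j) := by
        rw [card_powersetCard, card_sdiff_of_subset hsX, hsj]
      rw [← this]
      refine card_le_card_of_injOn (fun u => s ∪ u) ?_ ?_
      · intro u hu
        rw [mem_coe, mem_powersetCard] at hu
        have hd : Disjoint s u := disjoint_of_subset_right hu.1 disjoint_sdiff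
        simp only [bipartiteAbove, coe_filter, mem_filter, mem_powersetCard, Set.mem_ofPred_eq]
        refine ⟨⟨⟨union_subset hsX (hu.1.trans sdiff_subset), ?_⟩,
          hP s _ subset_union_left hsP⟩, subset_union_left⟩
        rw [card_union_of_disjoint hd, hsj, hu.2]; omega
      · intro u hu v hv huv
        rw [mem_coe, mem_powersetCard] at hu hv
        have hdu : Disjoint u s := (disjoint_of_subset_right hu.1 disjoint_sdiff).symm
        have hdv : Disjoint v s := (disjoint_of_subset_right hv.1 disjoint_sdiff).symm
        have h2 : (s ∪ u) \ s = (s ∪ v) \ s := by simp only at huv; rw [huv]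
        rwa [union_sdiff_cancel_left hdu.symm, union_sdiff_cancel_left hdv.symm] at h2
    · intro t ht
      rw [mem_filter, mem_powersetCard] at ht
      rw [← ht.1.2, ← card_powersetCard j t]
      refine card_le_card ?_
      intro s hs
      simp only [bipartiteBelow, mem_filter, mem_powersetCard] at hs ⊢
      exact ⟨hs.2, hs.1.1.2⟩
  have hc := Nat.choose_mul (n := #X) hjk
  have hpos : 0 < k.choose j := Nat.choose_pos hjk
  refine Nat.le_of_mul_le_mul_right ?_ hpos
  calc _ = #{T ∈ powersetCard j X | P T} * ((#X).choose k * k.choose j) := by ring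
    _ = #{T ∈ powersetCard j X | P T} * (#X - j).choose (k - j) * (#X).choose j := by
        rw [hc]; ring
    _ ≤ #{T ∈ powersetCard k X | P T} * k.choose j * (#X).choose j :=
        Nat.mul_le_mul_right _ key
    _ = _ := by ring

open Finset in
/-- The colourings of `X` in which the colour class of `z` is a small member of a monotone family
are at most as frequent as the members of the family among the `k`-subsets. -/
theorem card_colouring_mul_choose_le {α β : Type*} [Fintype α] [Fintype β] [DecidableEq α]
    [DecidableEq β] (z : β)
    (X : Finset α) (P : Finset α → Prop) [DecidablePred P] (hP : ∀ s t, s ⊆ t → P s → P t)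
    (k : ℕ) :
    #{c : α → β | #{x ∈ X | c x = z} ≤ k ∧ P {x ∈ X | c x = z}} * (#X).choose k ≤
      Fintype.card β ^ Fintype.card α * #{T ∈ powersetCard k X | P T} := by
  -- The number of colourings whose class of `z` in `X` is a given `j`-set. It depends on `j` alone,
  -- so given its size the class is uniform and the layers can be compared one by one.
  set w : ℕ → ℕ := fun j => (Fintype.card β - 1) ^ (#X - j) *
    Fintype.card β ^ (Fintype.card α - #X) with hw
  have hfib : ∀ T ∈ X.powerset, #{c : α → β | {x ∈ X | c x = z} = T} = w #T := by
    intro T hT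
    rw [mem_powerset] at hT
    have : ({c : α → β | {x ∈ X | c x = z} = T} : Finset (α → β)) =
        Fintype.piFinset (fun x => if x ∈ T then {z} else
          if x ∈ X then univ.erase z else univ) := by
      ext c
      simp only [mem_filter, mem_univ, true_and, Fintype.mem_piFinset, Finset.ext_iff]
      refine forall_congr' fun x => ?_
      by_cases h1 : x ∈ T
      · have := hT h1
        simp [h1, this]
      · by_cases h2 : x ∈ X <;> simp [h1, h2]
    rw [this, Fintype.card_piFinset]
    have h3 : ∀ x, #(if x ∈ T then {z} else if x ∈ X then univ.erase z else univ : Finset β) =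
      if x ∈ T then 1 else if x ∈ X then Fintype.card β - 1 else Fintype.card β := by
      intro x
      split_ifs <;> simp [card_erase_of_mem]
    simp_rw [h3, prod_ite, prod_const, one_pow, one_mul, hw]
    congr 2
    · rw [← card_sdiff_of_subset hT]; congr 1; ext x; simp [and_comm]
    · rw [← card_univ, ← card_sdiff_of_subset (subset_univ X)]; congr 1; ext x; simp
      exact fun h hx => h (hT hx)
  have hcount : ∀ Q : Finset α → Prop, ∀ [DecidablePred Q],
      #{c : α → β | Q {x ∈ X | c x = z}} = ∑ T ∈ X.powerset with Q T, w #T := by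
    intro Q _
    rw [card_eq_sum_card_fiberwise (f := fun c => ({x ∈ X | c x = z} : Finset α))
      (t := X.powerset.filter Q)]
    · refine sum_congr rfl fun T hT => ?_
      rw [mem_filter] at hT
      rw [← hfib T hT.1, filter_filter]
      congr 1
      ext c
      simp only [mem_filter, mem_univ, true_and, and_iff_right_iff_imp]
      intro h; rw [h]; exact hT.2
    · intro c hc
      simp only [coe_filter, mem_univ, true_and, Set.mem_ofPred_eq, mem_powerset] at hc ⊢
      exact ⟨filter_subset _ _, hc⟩
  have hlevel : ∀ Q : Finset α → Prop, ∀ [DecidablePred Q],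
      ∑ T ∈ X.powerset with (#T ≤ k ∧ Q T), w #T =
        ∑ j ∈ range (k + 1), w j * #{T ∈ powersetCard j X | Q T} := by
    intro Q _
    rw [← sum_fiberwise_of_maps_to (g := card) (t := range (k + 1))]
    · refine sum_congr rfl fun j hj => ?_
      rw [mul_comm, ← smul_eq_mul, ← sum_const]
      have : ({T ∈ {T ∈ X.powerset | #T ≤ k ∧ Q T} | #T = j} : Finset (Finset α)) =
          {T ∈ powersetCard j X | Q T} := by
        ext T
        simp only [mem_filter, mem_powerset, mem_powersetCard]
        rw [mem_range] at hj
        constructor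
        · rintro ⟨⟨h1, h2, h3⟩, h4⟩; exact ⟨⟨h1, h4⟩, h3⟩
        · rintro ⟨⟨h1, h2⟩, h3⟩; exact ⟨⟨h1, by omega, h3⟩, h2⟩
      rw [this]
      refine sum_congr rfl fun T hT => ?_
      rw [mem_filter, mem_powersetCard] at hT
      rw [hT.1.2]
    · intro T hT
      rw [mem_filter] at hT
      rw [mem_range]; omega
  have h1 := hcount (fun T => #T ≤ k ∧ P T)
  -- The trivial family supplies the normalisation: the total weight of the layers up to `k` is at
  -- most the number of colourings.
  have h2 := hcount (fun T => #T ≤ k ∧ True)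
  rw [hlevel P] at h1
  rw [hlevel (fun _ => True)] at h2
  have h3 : #{c : α → β | #{x ∈ X | c x = z} ≤ k ∧ True} ≤
      Fintype.card β ^ Fintype.card α := by
    refine (card_le_univ _).trans_eq ?_
    rw [Fintype.card_fun]
  rw [h2] at h3
  rw [h1, sum_mul]
  refine le_trans ?_ (Nat.mul_le_mul_right _ h3)
  rw [sum_mul]
  refine sum_le_sum fun j hj => ?_
  rw [mem_range] at hj
  have := card_filter_powersetCard_mul_choose_le X P hP (Nat.lt_succ_iff.1 hj)
  simp only [filter_true, card_powersetCard]
  calc _ = w j * (#{T ∈ powersetCard j X | P T} * (#X).choose k) := by ring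
    _ ≤ w j * (#{T ∈ powersetCard k X | P T} * (#X).choose j) := Nat.mul_le_mul_left _ this
    _ = _ := by ring

/-! ### Hitting blocks in a random colouring -/

open Finset in
/-- The frequency of an event that depends on the colours of the elements of an embedded set. -/
theorem card_filter_comp_mul {ι α β : Type*} [Fintype ι] [Fintype α] [Fintype β] [DecidableEq ι]
    [DecidableEq α]
    (φ : ι → α) (hφ : Function.Injective φ) (P : (ι → β) → Prop) [DecidablePred P] :
    #{c : α → β | P (c ∘ φ)} * Fintype.card β ^ Fintype.card ι =
      #{d : ι → β | P d} * Fintype.card β ^ Fintype.card α := by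
  classical
  let e : ι ⊕ {a // a ∉ Set.range φ} ≃ α :=
    ((Equiv.ofInjective φ hφ).sumCongr (Equiv.refl _)).trans (Equiv.Set.sumCompl (Set.range φ))
  have he : ∀ i, e (Sum.inl i) = φ i := fun i => rfl
  let E : (α → β) ≃ (ι → β) × ({a // a ∉ Set.range φ} → β) :=
    (e.arrowCongr (Equiv.refl β)).symm.trans (Equiv.sumArrowEquivProdArrow _ _ _)
  have hE : ∀ c, (E c).1 = c ∘ φ := fun c => rfl
  have h1 : #{c : α → β | P (c ∘ φ)} =
      #{d : ι → β | P d} * Fintype.card ({a // a ∉ Set.range φ} → β) := by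
    rw [← card_univ (α := {a // a ∉ Set.range φ} → β), ← card_product]
    refine card_equiv E fun c => ?_
    simp [hE]
  rw [h1, Fintype.card_fun, mul_assoc, ← pow_add]
  congr 2
  rw [← Fintype.card_congr e, Fintype.card_sum, add_comm]

open Finset in
theorem card_filter_forall_ne {J β : Type*} [Fintype J] [Fintype β] [DecidableEq β]
    [DecidableEq J] (z : β) :
    (#{d : J → β | ∀ j, d j ≠ z} : ℝ) =
      Fintype.card β ^ Fintype.card J * (1 - 1 / (Fintype.card β : ℝ)) ^ Fintype.card J := by
  have h1 : ({d : J → β | ∀ j, d j ≠ z} : Finset (J → β)) =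
      Fintype.piFinset (fun _ => univ.erase z) := by
    ext d; simp
  have hM : 0 < Fintype.card β := Fintype.card_pos_iff.2 ⟨z⟩
  have hM' : (Fintype.card β : ℝ) ≠ 0 := by exact_mod_cast hM.ne'
  rw [h1, Fintype.card_piFinset, prod_const, card_erase_of_mem (mem_univ z), card_univ, card_univ,
    Nat.cast_pow, Nat.cast_sub hM, ← mul_pow]
  congr 1
  field_simp
  simp

open Finset in
/-- The probability that in a random colouring each block `i` has a part `b` none of whose elements
has the colour `z`. -/
theorem card_filter_blocks {I B J β : Type*} [Fintype I] [Fintype B] [Fintype J] [Fintype β]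
    [DecidableEq I] [DecidableEq B] [DecidableEq J] [DecidableEq β] (z : β) :
    (#{d : I → B → J → β | ∀ i, ∃ b, ∀ j, d i b j ≠ z} : ℝ) =
      Fintype.card (I → B → J → β) * (1 - (1 - (1 - 1 / (Fintype.card β : ℝ)) ^ Fintype.card J)
        ^ Fintype.card B) ^ Fintype.card I := by
  set x : ℝ := (1 - 1 / (Fintype.card β : ℝ)) ^ Fintype.card J with hx
  have hJ : (#{d : J → β | ¬ ∀ j, d j ≠ z} : ℝ) = Fintype.card (J → β) * (1 - x) := by
    have h := card_filter_add_card_filter_not (s := (univ : Finset (J → β))) (fun d => ∀ j, d j ≠ z)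
    rw [card_univ] at h
    have h' : (#{d : J → β | ∀ j, d j ≠ z} : ℝ) + #{d : J → β | ¬ ∀ j, d j ≠ z} =
      Fintype.card (J → β) := by exact_mod_cast h
    rw [card_filter_forall_ne, ← hx] at h'
    rw [Fintype.card_fun] at h' ⊢
    push_cast at h' ⊢
    linarith
  have hB : (#{d : B → J → β | ¬ ∃ b, ∀ j, d b j ≠ z} : ℝ) =
      Fintype.card (B → J → β) * (1 - x) ^ Fintype.card B := by
    have h1 : ({d : B → J → β | ¬ ∃ b, ∀ j, d b j ≠ z} : Finset (B → J → β)) =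
        Fintype.piFinset (fun _ => {d : J → β | ¬ ∀ j, d j ≠ z}) := by
      ext d; simp
    rw [h1, Fintype.card_piFinset, prod_const, card_univ, Nat.cast_pow, hJ, mul_pow,
      Fintype.card_fun (α := B)]
    push_cast; rfl
  have hB' : (#{d : B → J → β | ∃ b, ∀ j, d b j ≠ z} : ℝ) =
      Fintype.card (B → J → β) * (1 - (1 - x) ^ Fintype.card B) := by
    have h := card_filter_add_card_filter_not (s := (univ : Finset (B → J → β)))
      (fun d => ∃ b, ∀ j, d b j ≠ z)
    rw [card_univ] at h
    have h' : (#{d : B → J → β | ∃ b, ∀ j, d b j ≠ z} : ℝ) +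
      #{d : B → J → β | ¬ ∃ b, ∀ j, d b j ≠ z} = Fintype.card (B → J → β) := by exact_mod_cast h
    rw [hB] at h'
    linarith
  have h1 : ({d : I → B → J → β | ∀ i, ∃ b, ∀ j, d i b j ≠ z} : Finset (I → B → J → β)) =
      Fintype.piFinset (fun _ => {d : B → J → β | ∃ b, ∀ j, d b j ≠ z}) := by
    ext d; simp
  rw [h1, Fintype.card_piFinset, prod_const, card_univ, Nat.cast_pow, hB', mul_pow,
    Fintype.card_fun (α := I)]
  push_cast; rfl

/-- For some block `i`, the set `T` meets each of the parts `φ (i, b, ·)`. -/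
def MeetsBlock {I B J α : Type*} (φ : I × B × J → α) (T : Finset α) : Prop :=
  ∃ i, ∀ b, ∃ j, φ (i, b, j) ∈ T

theorem MeetsBlock.mono {I B J α : Type*} {φ : I × B × J → α} {T T' : Finset α} (h : T ⊆ T')
    (hT : MeetsBlock φ T) : MeetsBlock φ T' := by
  obtain ⟨i, hi⟩ := hT
  exact ⟨i, fun b => (hi b).imp fun j hj => h hj⟩

-- Distinct `φ p` receive independent colours, so the product formula of `card_filter_blocks`
-- transfers along the injection `φ`.
open Finset Classical in
theorem card_not_meetsBlock {I B J α β : Type*} [Fintype I] [Fintype B] [Fintype J] [Fintype α]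
    [Fintype β] [DecidableEq β] (z : β) (φ : I × B × J → α) (hφ : Function.Injective φ) (X : Finset α)
    (hX : ∀ p, φ p ∈ X) :
    (#{c : α → β | ¬ MeetsBlock φ {x ∈ X | c x = z}} : ℝ) =
      Fintype.card (α → β) * (1 - (1 - (1 - 1 / (Fintype.card β : ℝ)) ^ Fintype.card J)
        ^ Fintype.card B) ^ Fintype.card I := by
  have hM : 0 < Fintype.card β := Fintype.card_pos_iff.2 ⟨z⟩
  have hM' : (Fintype.card β : ℝ) ≠ 0 := by exact_mod_cast hM.ne'
  have h1 := card_filter_comp_mul (β := β) φ hφ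
    (fun d => ∀ i, ∃ b, ∀ j, d (i, b, j) ≠ z)
  have h2 : #{d : I × B × J → β | ∀ i, ∃ b, ∀ j, d (i, b, j) ≠ z} =
      #{d : I → B → J → β | ∀ i, ∃ b, ∀ j, d i b j ≠ z} := by
    refine card_equiv ((Equiv.curry I (B × J) β).trans
      (Equiv.piCongrRight fun _ => Equiv.curry B J β)) fun d => ?_
    simp [Function.curry]
  have h3 : #{c : α → β | ¬ MeetsBlock φ {x ∈ X | c x = z}} =
      #{c : α → β | ∀ i, ∃ b, ∀ j, (c ∘ φ) (i, b, j) ≠ z} := by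
    congr 1; ext c; simp [MeetsBlock, hX]
  have h4 : (#{d : I × B × J → β | ∀ i, ∃ b, ∀ j, d (i, b, j) ≠ z} : ℝ) = _ :=
    (congrArg (Nat.cast (R := ℝ)) h2).trans (card_filter_blocks z)
  have h5 : (#{c : α → β | ∀ i, ∃ b, ∀ j, (c ∘ φ) (i, b, j) ≠ z} : ℝ) *
      (Fintype.card β : ℝ) ^ Fintype.card (I × B × J) = 
      #{d : I × B × J → β | ∀ i, ∃ b, ∀ j, d (i, b, j) ≠ z} *
        (Fintype.card β : ℝ) ^ Fintype.card α := by exact_mod_cast h1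
  rw [h3]
  rw [h4] at h5
  have h6 : (Fintype.card (I → B → J → β) : ℝ) =
      (Fintype.card β : ℝ) ^ Fintype.card (I × B × J) := by
    simp only [Fintype.card_fun, Fintype.card_prod, Nat.cast_pow, ← pow_mul]
    congr 1; ring
  rw [h6] at h5
  rw [Fintype.card_fun, Nat.cast_pow]
  have h7 : (Fintype.card β : ℝ) ^ Fintype.card (I × B × J) ≠ 0 := pow_ne_zero _ hM'
  refine mul_right_cancel₀ h7 (h5.trans (by ring))

-- Markov's inequality: the class of `z` in `X` has mean size `#X / Fintype.card β`.
open Finset in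
theorem card_colour_class_gt_le {α β : Type*} [Fintype α] [Fintype β] [DecidableEq α]
    [DecidableEq β] (z : β) (X : Finset α) (k : ℕ) :
    k * Fintype.card β * #{c : α → β | k < #{x ∈ X | c x = z}} ≤
      #X * Fintype.card (α → β) := by
  have h1 : ∀ x : α, #{c : α → β | c x = z} * Fintype.card β = Fintype.card (α → β) := by
    intro x
    have := card_filter_comp_mul (β := β) (fun _ : Unit => x) (fun _ _ _ => rfl)
      (fun d => d () = z)
    have h2 : #{d : Unit → β | d () = z} = 1 := by
      rw [card_eq_one]
      exact ⟨fun _ => z, by ext d; simp [funext_iff, Unique.forall_iff]⟩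
    rw [h2] at this
    simpa using this
  have h2 : ∑ c : α → β, #{x ∈ X | c x = z} = ∑ x ∈ X, #{c : α → β | c x = z} := by
    simp_rw [card_filter]
    exact sum_comm
  calc _ = (∑ c : α → β with k < #{x ∈ X | c x = z}, k) * Fintype.card β := by
        rw [sum_const, smul_eq_mul]; ring
    _ ≤ (∑ c : α → β, #{x ∈ X | c x = z}) * Fintype.card β := by
        refine Nat.mul_le_mul_right _ ?_
        refine le_trans (sum_le_sum fun c hc => ?_) (sum_le_sum_of_subset (filter_subset _ _))
        exact (mem_filter.1 hc).2.le
    _ = #X * Fintype.card (α → β) := by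
        rw [h2, sum_mul, sum_congr rfl fun x _ => h1 x, sum_const, smul_eq_mul]

open Finset Classical in
/-- At least half of the `k`-subsets of `X` meet a block of each of two block systems, if the
blocks are numerous and large enough. -/
theorem choose_le_two_mul_card_meetsBlock {I₁ B₁ J₁ I₂ B₂ J₂ α : Type*} [Fintype I₁] [Fintype B₁]
    [Fintype J₁] [Fintype I₂] [Fintype B₂] [Fintype J₂] [Fintype α]
    (φ₁ : I₁ × B₁ × J₁ → α) (hφ₁ : Function.Injective φ₁)
    (φ₂ : I₂ × B₂ × J₂ → α) (hφ₂ : Function.Injective φ₂) (X : Finset α)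
    (hX₁ : ∀ p, φ₁ p ∈ X) (hX₂ : ∀ p, φ₂ p ∈ X) (hX0 : 0 < #X) (k M : ℕ) (hM : 0 < M)
    (hk : 4 * #X ≤ k * M)
    (h₁ : (1 - (1 - (1 - 1 / (M : ℝ)) ^ Fintype.card J₁) ^ Fintype.card B₁) ^ Fintype.card I₁ ≤
      1 / 8)
    (h₂ : (1 - (1 - (1 - 1 / (M : ℝ)) ^ Fintype.card J₂) ^ Fintype.card B₂) ^ Fintype.card I₂ ≤
      1 / 8) :
    (#X).choose k ≤ 2 * #{T ∈ powersetCard k X | MeetsBlock φ₁ T ∧ MeetsBlock φ₂ T} := by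
  obtain ⟨M, rfl⟩ : ∃ M', M = M' + 1 := ⟨M - 1, by omega⟩
  have hcol := card_colouring_mul_choose_le (0 : Fin (M + 1)) X
    (fun T => MeetsBlock φ₁ T ∧ MeetsBlock φ₂ T) (fun s t hst h => ⟨h.1.mono hst, h.2.mono hst⟩) k
  have hgt := card_colour_class_gt_le (0 : Fin (M + 1)) X k
  have b₁ := card_not_meetsBlock (0 : Fin (M + 1)) φ₁ hφ₁ X hX₁
  have b₂ := card_not_meetsBlock (0 : Fin (M + 1)) φ₂ hφ₂ X hX₂
  rw [Fintype.card_fin] at b₁ b₂ hgt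
  rw [← Fintype.card_fun (α := α)] at hcol
  set Ω : ℕ := Fintype.card (α → Fin (M + 1)) with hΩ
  set Z : (α → Fin (M + 1)) → Finset α := fun c => {x ∈ X | c x = 0} with hZ
  have c₁ : (#{c : α → Fin (M + 1) | ¬ MeetsBlock φ₁ (Z c)} : ℝ) ≤ Ω * (1 / 8) := by
    rw [b₁]; exact mul_le_mul_of_nonneg_left h₁ (Nat.cast_nonneg _)
  have c₂ : (#{c : α → Fin (M + 1) | ¬ MeetsBlock φ₂ (Z c)} : ℝ) ≤ Ω * (1 / 8) := by
    rw [b₂]; exact mul_le_mul_of_nonneg_left h₂ (Nat.cast_nonneg _)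
  have c₃ : 4 * #{c : α → Fin (M + 1) | k < #(Z c)} ≤ Ω := by
    refine Nat.le_of_mul_le_mul_left ?_ hX0
    calc _ = 4 * #X * #{c : α → Fin (M + 1) | k < #(Z c)} := by ring
      _ ≤ k * (M + 1) * #{c : α → Fin (M + 1) | k < #(Z c)} := Nat.mul_le_mul_right _ hk
      _ ≤ _ := hgt
  -- Union bound: the three failures have frequencies at most `1/8`, `1/8` and `1/4`, which leaves
  -- at least `1/2`.
  have c₄ : Ω ≤ #{c : α → Fin (M + 1) | #(Z c) ≤ k ∧ MeetsBlock φ₁ (Z c) ∧ MeetsBlock φ₂ (Z c)} +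
      #{c : α → Fin (M + 1) | ¬ MeetsBlock φ₁ (Z c)} +
      #{c : α → Fin (M + 1) | ¬ MeetsBlock φ₂ (Z c)} +
      #{c : α → Fin (M + 1) | k < #(Z c)} := by
    rw [hΩ, ← card_univ]
    refine le_trans (card_le_card (t := _ ∪ _ ∪ _ ∪ _) ?_) ((card_union_le _ _).trans
      (Nat.add_le_add_right ((card_union_le _ _).trans
      (Nat.add_le_add_right (card_union_le _ _) _)) _))
    intro c _
    simp only [mem_union, mem_filter, mem_univ, true_and]
    by_cases h1 : MeetsBlock φ₁ (Z c) <;> by_cases h2 : MeetsBlock φ₂ (Z c) <;>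
      simp [h1, h2, le_or_gt]
  have hΩ0 : 0 < Ω := Fintype.card_pos
  have c₅ : Ω ≤ 2 * #{c : α → Fin (M + 1) | #(Z c) ≤ k ∧ MeetsBlock φ₁ (Z c) ∧
      MeetsBlock φ₂ (Z c)} := by
    have c₃' : 4 * (#{c : α → Fin (M + 1) | k < #(Z c)} : ℝ) ≤ Ω := by exact_mod_cast c₃
    have c₄' : (Ω : ℝ) ≤ #{c : α → Fin (M + 1) | #(Z c) ≤ k ∧ MeetsBlock φ₁ (Z c) ∧
      MeetsBlock φ₂ (Z c)} + #{c : α → Fin (M + 1) | ¬ MeetsBlock φ₁ (Z c)} +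
      #{c : α → Fin (M + 1) | ¬ MeetsBlock φ₂ (Z c)} +
      #{c : α → Fin (M + 1) | k < #(Z c)} := by exact_mod_cast c₄
    have : (Ω : ℝ) ≤ 2 * #{c : α → Fin (M + 1) | #(Z c) ≤ k ∧ MeetsBlock φ₁ (Z c) ∧
      MeetsBlock φ₂ (Z c)} := by linarith
    exact_mod_cast this
  refine Nat.le_of_mul_le_mul_left ?_ hΩ0
  calc Ω * (#X).choose k ≤ 2 * #{c : α → Fin (M + 1) | #(Z c) ≤ k ∧ MeetsBlock φ₁ (Z c) ∧
      MeetsBlock φ₂ (Z c)} * (#X).choose k := Nat.mul_le_mul_right _ c₅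
    _ = 2 * (#{c : α → Fin (M + 1) | #(Z c) ≤ k ∧ MeetsBlock φ₁ (Z c) ∧
      MeetsBlock φ₂ (Z c)} * (#X).choose k) := by ring
    _ ≤ 2 * (Ω * #{T ∈ powersetCard k X | MeetsBlock φ₁ T ∧ MeetsBlock φ₂ T}) :=
        Nat.mul_le_mul_left _ hcol
    _ = _ := by ring

/-! ### The law of the reservoir -/

/-- The law of the reservoir after reading a stream, when `t` elements have been read before. -/
def reservoirRun {α : Type*} (k : ℕ) : List α → ℕ → Finset α → PMF (Finset α)
  | [], _, R => PMF.pure R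
  | e :: s, t, R => (reservoirStep k t R e).bind (reservoirRun k s (t + 1))

/-- The recursion peels off the first element, whereas the law of the reservoir is computed by
induction on the last one. -/
theorem reservoirRun_append_singleton {α : Type*} (k : ℕ) (s : List α) (e : α) (t : ℕ)
    (R : Finset α) :
    reservoirRun k (s ++ [e]) t R =
      (reservoirRun k s t R).bind fun R' => reservoirStep k (t + s.length) R' e := by
  induction s generalizing t R with
  | nil =>
    simp only [List.nil_append, reservoirRun, PMF.pure_bind, List.length_nil, add_zero]
    exact PMF.bind_pure _
  | cons x s ih =>
    simp only [List.cons_append, reservoirRun, PMF.bind_bind, List.length_cons]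
    congr 1
    funext R'
    rw [ih]
    congr 2
    funext R''
    congr 1
    omega

theorem map_reservoir_dcRun {V : Type*} (k c h : ℕ) (s : List (Sym2 V)) (st : DCState V) :
    (dcRun k c h s st).map DCState.reservoir = reservoirRun k s st.read st.reservoir := by
  induction s generalizing st with
  | nil => simp [dcRun, reservoirRun, PMF.pure_map]
  | cons e s ih =>
    simp only [dcRun, reservoirRun, PMF.map_bind, dcStep, PMF.bind_map]
    congr 1
    funext R
    simp [ih]

/-- The update made when the stream stops renders the period `c` irrelevant to the final report. -/
theorem comps_of_mem_support_dcRun {V : Type*} (k c h : ℕ) (s : List (Sym2 V)) (st st' : DCState V)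
    (hst : st' ∈ (dcRun k c h s st).support) : st'.comps = largeComponents h st'.reservoir := by
  induction s generalizing st with
  | nil =>
    simp only [dcRun, PMF.support_pure, Set.mem_singleton_iff] at hst
    rw [hst]
  | cons e s ih =>
    simp only [dcRun, PMF.mem_support_bind_iff] at hst
    obtain ⟨st₁, -, h₁⟩ := hst
    exact ih st₁ h₁

/-- An event that holds whenever the reservoir lies in `P` and the large components are up to date
is at least as likely as `P` under the law of the reservoir. -/
theorem reservoirRun_le_dcAlgorithm {V : Type*} (k c h : ℕ) (s : List (Sym2 V))
    (P : Set (Finset (Sym2 V))) (Q : Set (DCState V))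
    (hPQ : ∀ st, st.reservoir ∈ P → st.comps = largeComponents h st.reservoir → st ∈ Q) :
    (reservoirRun k s 0 ∅).toOuterMeasure P ≤ (dcAlgorithm k c h s).toOuterMeasure Q := by
  have := map_reservoir_dcRun k c h s { read := 0, reservoir := ∅, nodes := ∅, comps := ∅ }
  simp only at this
  rw [← this, PMF.toOuterMeasure_map_apply]
  refine PMF.toOuterMeasure_mono _ ?_
  rintro st ⟨h1, h2⟩
  exact hPQ st h1 (comps_of_mem_support_dcRun k c h s _ st h2)

open Classical in
theorem reservoirRun_eq_pure {α : Type*} (k : ℕ) (s : List α) (hs : s.length ≤ k) :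
    reservoirRun k s 0 ∅ = PMF.pure s.toFinset := by
  induction s using List.reverseRecOn with
  | nil => simp [reservoirRun]
  | append_singleton s e ih =>
    rw [List.length_append, List.length_singleton] at hs
    rw [reservoirRun_append_singleton, ih (by omega), PMF.pure_bind, reservoirStep,
      if_pos (by omega)]
    congr 1
    ext x
    simp

open Finset Classical in
/-- An unselected element leaves the reservoir as it is. -/
theorem le_reservoirStep_self {α : Type*} {k t : ℕ} (hkt : k ≤ t) (R : Finset α) (e : α) :
    ((t + 1 - k : ℕ) : ENNReal) * ((t + 1 : ℕ) : ENNReal)⁻¹ ≤ reservoirStep k t R e R := by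
  rw [reservoirStep, if_neg (by omega), PMF.bind_apply, tsum_fintype]
  have hc : #{i : Fin (t + 1) | ¬ (i : ℕ) < k} = t + 1 - k := by
    have h := card_filter_add_card_filter_not (s := (univ : Finset (Fin (t + 1))))
      (fun i => (i : ℕ) < k)
    rw [Fin.card_filter_val_lt, card_univ, Fintype.card_fin] at h
    omega
  calc _ = ∑ i ∈ univ.filter (fun i : Fin (t + 1) => ¬ (i : ℕ) < k), ((t + 1 : ℕ) : ENNReal)⁻¹ := by
        rw [sum_const, hc, nsmul_eq_mul]
    _ ≤ _ := by
        refine le_trans (le_of_eq (sum_congr rfl fun i hi => ?_))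
          (sum_le_sum_of_subset (filter_subset (fun i : Fin (t + 1) => ¬ (i : ℕ) < k) univ))
        rw [mem_filter] at hi
        rw [dif_neg (fun h => hi.2 h.1)]
        simp

open Finset Classical in
/-- A selected element replaces a given element of a full reservoir. -/
theorem le_reservoirStep_insert_erase {α : Type*} {k t : ℕ} (hk : 0 < k) (hkt : k ≤ t)
    (R : Finset α) (hR : #R = k) (e f : α) (hf : f ∈ R) :
    ((t + 1 : ℕ) : ENNReal)⁻¹ ≤ reservoirStep k t R e (insert e (R.erase f)) := by
  rw [reservoirStep, if_neg (by omega), PMF.bind_apply, tsum_fintype]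
  have hRn : R.Nonempty := ⟨f, hf⟩
  have hc : #{i : Fin (t + 1) | (i : ℕ) < k} = k := by
    rw [Fin.card_filter_val_lt]; omega
  have hk0 : (k : ENNReal) ≠ 0 := by exact_mod_cast hk.ne'
  -- Selection has probability `k / (t + 1)` and the choice of `f` probability `1 / k`.
  calc _ = ∑ i ∈ univ.filter (fun i : Fin (t + 1) => (i : ℕ) < k),
        ((t + 1 : ℕ) : ENNReal)⁻¹ * (k : ENNReal)⁻¹ := by
        rw [sum_const, hc, nsmul_eq_mul, mul_comm, mul_assoc,
          ENNReal.inv_mul_cancel hk0 (ENNReal.natCast_ne_top k), mul_one]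
    _ ≤ _ := by
        refine le_trans (sum_le_sum fun i hi => ?_)
          (sum_le_sum_of_subset (filter_subset (fun i : Fin (t + 1) => (i : ℕ) < k) univ))
        rw [mem_filter] at hi
        rw [dif_pos ⟨hi.2, hRn⟩, PMF.uniformOfFintype_apply, Fintype.card_fin]
        refine mul_le_mul_right ?_ _
        rw [PMF.map_apply]
        refine le_trans (le_of_eq ?_) (ENNReal.le_tsum f)
        rw [if_pos rfl, PMF.uniformOfFinset_apply_of_mem hRn hf, hR]

open Finset Classical in
/-- Each `k`-subset of the elements read is the reservoir with at least the uniform probability. -/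
theorem inv_choose_le_reservoirRun {α : Type*} {k : ℕ} (hk : 0 < k) (s : List α) (hs : s.Nodup)
    (hks : k ≤ s.length) (R : Finset α) (hR : R ∈ powersetCard k s.toFinset) :
    (s.length.choose k : ENNReal)⁻¹ ≤ reservoirRun k s 0 ∅ R := by
  induction s using List.reverseRecOn generalizing R with
  | nil => simp at hks; omega
  | append_singleton s e ih =>
    rcases Nat.lt_or_ge s.length k with hlt | hge
    · have hl : (s ++ [e]).length = k := by simp at hks ⊢; omega
      rw [reservoirRun_eq_pure k _ hl.le, hl, Nat.choose_self]
      rw [mem_powersetCard] at hR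
      have : R = (s ++ [e]).toFinset :=
        eq_of_subset_of_card_le hR.1 (by rw [List.toFinset_card_of_nodup hs, hl, hR.2])
      simp [this]
    have hs' : s.Nodup := (List.nodup_append.1 hs).1
    have he : e ∉ s := by
      rw [List.nodup_append] at hs
      intro h; exact hs.2.2 e h e (by simp) rfl
    have ih' := ih hs' hge
    set t := s.length with ht
    have hlen : (s ++ [e]).length = t + 1 := by simp [ht]
    rw [mem_powersetCard] at hR
    rw [reservoirRun_append_singleton, hlen, PMF.bind_apply, zero_add]
    have hC0 : (t.choose k : ENNReal) ≠ 0 := by exact_mod_cast (Nat.choose_pos hge).ne'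
    have hT0 : ((t + 1 : ℕ) : ENNReal) ≠ 0 := by exact_mod_cast Nat.succ_ne_zero t
    have hid : (((t + 1).choose k : ℕ) : ENNReal)⁻¹ =
        (t.choose k : ENNReal)⁻¹ * (((t + 1 - k : ℕ) : ENNReal) * ((t + 1 : ℕ) : ENNReal)⁻¹) := by
      have h1 : t.choose k * (t + 1) = (t + 1).choose k * (t + 1 - k) :=
        Nat.choose_mul_succ_eq t k
      have h2 : (t.choose k : ENNReal) * ((t + 1 : ℕ) : ENNReal) =
        ((t + 1).choose k : ENNReal) * ((t + 1 - k : ℕ) : ENNReal) := by exact_mod_cast h1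
      have hD0 : ((t + 1 - k : ℕ) : ENNReal) ≠ 0 := by
        exact_mod_cast (by omega : t + 1 - k ≠ 0)
      have hE0 : ((t + 1).choose k : ENNReal) ≠ 0 := by
        exact_mod_cast (Nat.choose_pos (by omega : k ≤ t + 1)).ne'
      rw [mul_left_comm, ← ENNReal.mul_inv (Or.inl hC0) (Or.inl (ENNReal.natCast_ne_top _)), h2,
        ENNReal.mul_inv (Or.inl hE0) (Or.inl (ENNReal.natCast_ne_top _)), mul_left_comm,
        ENNReal.mul_inv_cancel hD0 (ENNReal.natCast_ne_top _), mul_one]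
    rw [hid]
    -- If `e ∈ R`, there are `t + 1 - k` possible predecessors, one for each replaced `f`, each
    -- leading to `R` with probability at least `1 / (t + 1)`. Otherwise `R` is its own predecessor
    -- and `e` is unselected with probability `(t + 1 - k) / (t + 1)`. Both cases give the factor in
    -- `hid`.
    by_cases heR : e ∈ R
    · have hsub : ∀ f ∈ s.toFinset \ R, insert f (R.erase e) ∈ powersetCard k s.toFinset := by
        intro f hf
        rw [mem_sdiff] at hf
        rw [mem_powersetCard]
        constructor
        · intro x hx
          rw [mem_insert, mem_erase] at hx
          rcases hx with rfl | ⟨hx, hxR⟩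
          · exact hf.1
          · have := hR.1 hxR
            simpa [hx] using this
        · rw [card_insert_of_notMem (fun h => hf.2 (mem_of_mem_erase h)), card_erase_of_mem heR,
            hR.2]
          omega
      have hinj : Set.InjOn (fun f => insert f (R.erase e)) (s.toFinset \ R : Finset α) := by
        intro f hf g hg hfg
        rw [mem_coe, mem_sdiff] at hf hg
        have : f ∈ insert g (R.erase e) := by
          simp only at hfg; rw [← hfg]; exact mem_insert_self _ _
        rw [mem_insert] at this
        rcases this with h | h
        · exact h
        · exact absurd (mem_of_mem_erase h) hf.2
      have hcard : #(s.toFinset \ R) = t + 1 - k := by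
        have h1 : s.toFinset ∩ R = R.erase e := by
          ext x
          rw [mem_inter, mem_erase, List.mem_toFinset]
          constructor
          · rintro ⟨h1, h2⟩; exact ⟨fun h => he (h ▸ h1), h2⟩
          · rintro ⟨h1, h2⟩
            have := hR.1 h2
            simp [h1] at this
            exact ⟨this, h2⟩
        have h2 := card_sdiff_add_card_inter s.toFinset R
        rw [h1, card_erase_of_mem heR, List.toFinset_card_of_nodup hs', hR.2] at h2
        omega
      calc _ = ∑ f ∈ s.toFinset \ R, (t.choose k : ENNReal)⁻¹ * ((t + 1 : ℕ) : ENNReal)⁻¹ := by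
            rw [sum_const, hcard, nsmul_eq_mul]; ring
        _ ≤ ∑ f ∈ s.toFinset \ R, reservoirRun k s 0 ∅ (insert f (R.erase e)) *
            reservoirStep k t (insert f (R.erase e)) e R := by
            refine sum_le_sum fun f hf => mul_le_mul' (ih' _ (hsub f hf)) ?_
            have h1 := le_reservoirStep_insert_erase hk hge (insert f (R.erase e))
              (mem_powersetCard.1 (hsub f hf)).2 e f (mem_insert_self _ _)
            rw [mem_sdiff] at hf
            rwa [erase_insert (fun h => hf.2 (mem_of_mem_erase h)), insert_erase heR] at h1
        _ = ∑ R' ∈ (s.toFinset \ R).image (fun f => insert f (R.erase e)),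
            reservoirRun k s 0 ∅ R' * reservoirStep k t R' e R := by rw [sum_image hinj]
        _ ≤ _ := ENNReal.sum_le_tsum _
    · have hRs : R ∈ powersetCard k s.toFinset := by
        rw [mem_powersetCard]
        refine ⟨fun x hx => ?_, hR.2⟩
        have := hR.1 hx
        have hxe : x ≠ e := fun h => heR (h ▸ hx)
        simpa [hxe] using this
      exact (mul_le_mul' (ih' R hRs) (le_reservoirStep_self hge R e)).trans (ENNReal.le_tsum R)

open Finset Classical in
theorem card_div_choose_le_reservoirRun {α : Type*} {k : ℕ} (hk : 0 < k) (s : List α)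
    (hs : s.Nodup) (hks : k ≤ s.length) (P : Finset α → Prop)
    [DecidablePred P] :
    (#{R ∈ powersetCard k s.toFinset | P R} : ENNReal) * (s.length.choose k : ENNReal)⁻¹ ≤
      (reservoirRun k s 0 ∅).toOuterMeasure {R | P R} := by
  calc _ = ∑ R ∈ powersetCard k s.toFinset with P R, (s.length.choose k : ENNReal)⁻¹ := by
        rw [sum_const, nsmul_eq_mul]
    _ ≤ ∑ R ∈ powersetCard k s.toFinset with P R, reservoirRun k s 0 ∅ R :=
        sum_le_sum fun R hR =>
          inv_choose_le_reservoirRun hk s hs hks R (mem_filter.1 hR).1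
    _ = (reservoirRun k s 0 ∅).toOuterMeasure
          (({R ∈ powersetCard k s.toFinset | P R} : Finset (Finset α)) : Set (Finset α)) :=
        (PMF.toOuterMeasure_apply_finset _ _).symm
    _ ≤ _ := PMF.toOuterMeasure_mono _ fun R hR => by
        have := hR.1
        rw [mem_coe, mem_filter] at this
        exact this.2

/-! ### Stars inside a community -/

/-- Stars in `S`, with distinct centres `u i` and with leaves `v i p` that are not centres. -/
structure IsStarSystem {V I K : Type*} (G : SimpleGraph V) (S : Set V) (u : I → V)
    (v : I → K → V) : Prop where
  center_injective : Function.Injective u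
  leaf_injective : ∀ i, Function.Injective (v i)
  leaf_ne : ∀ i p i', v i p ≠ u i'
  center_mem : ∀ i, u i ∈ S
  leaf_mem : ∀ i p, v i p ∈ S
  adj : ∀ i p, G.Adj (u i) (v i p)

theorem IsStarSystem.comp {V I K K' : Type*} {G : SimpleGraph V} {S : Set V} {u : I → V}
    {v : I → K → V} (h : IsStarSystem G S u v) (g : K' → K) (hg : Function.Injective g) :
    IsStarSystem G S u (fun i p => v i (g p)) where
  center_injective := h.center_injective
  leaf_injective i := (h.leaf_injective i).comp hg
  leaf_ne i p := h.leaf_ne i (g p)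
  center_mem := h.center_mem
  leaf_mem i p := h.leaf_mem i (g p)
  adj i p := h.adj i (g p)

/-- In a power law graph, each community contains about `√n` stars with about `√n` leaves. -/
theorem exists_isStarSystem {V : Type*} [Fintype V] {L A : ℝ} (hL : 1 ≤ L) {D : ℕ → ℕ}
    {G : SimpleGraph V} {S : Set V} (hD : HasDegreeDistribution G D)
    (hpl : IsPowerLaw L (Nat.card V) D) (hS : IsCommunity A G S) (r : ℕ)
    (hr : L * (8 * r : ℝ) ^ 2 ≤ Nat.card V) :
    ∃ (u : Fin r → V) (v : Fin r → Fin r → V), IsStarSystem G S u v := by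
  classical
  rcases Nat.eq_zero_or_pos r with rfl | hr0
  · exact ⟨fun i => i.elim0, fun i => i.elim0, fun i => i.elim0, fun i => i.elim0,
      fun i => i.elim0, fun i => i.elim0, fun i => i.elim0, fun i => i.elim0⟩
  set d : V → ℕ := fun v => (G.neighborSet v).ncard with hd
  have hL0 : 0 < L := by linarith
  -- For these `j` the lower bound of the power law is in force, so every such degree occurs.
  have hdeg : ∀ j, 1 ≤ j → j ≤ 8 * r → ∃ x, d x = j := by
    intro j h1 h2
    have hj0 : (0 : ℝ) < j := by exact_mod_cast h1
    have hj : (j : ℝ) ≤ 8 * r := by exact_mod_cast h2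
    have h3 : L * (j : ℝ) ^ 2 ≤ Nat.card V := le_trans (by gcongr) hr
    have h4 := (hpl j h1).2 h3
    have h5 : (0 : ℝ) < D j := lt_of_lt_of_le (by
      have : 0 < L * (j : ℝ) ^ 2 := by positivity
      exact div_pos (this.trans_le h3) this) h4
    have h6 : D j ≠ 0 := by intro h; simp [h] at h5
    rw [← hD.2 j] at h6
    exact Set.nonempty_of_ncard_ne_zero h6
  obtain ⟨x, hxS, hx⟩ : ∃ x ∈ S, 8 * r ≤ d x := by
    obtain ⟨w, hw⟩ := hdeg (8 * r) (by omega) le_rfl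
    by_cases hwS : w ∈ S
    · exact ⟨w, hwS, hw.ge⟩
    · obtain ⟨y, hy⟩ := hS.nonempty
      exact ⟨y, hy, hw.symm.trans_le (hS.highest y hy w hwS)⟩
  have hScard : 4 * r ≤ S.ncard := by
    have h1 := hS.dense x hxS
    have h2 := Set.ncard_le_ncard (Set.inter_subset_right (s := G.neighborSet x) (t := S))
      (Set.toFinite _)
    have h3 : 8 * r ≤ (G.neighborSet x).ncard := hx
    omega
  set T : Set V := {x | 4 * r ≤ d x} with hT
  have hTcard : 4 * r ≤ T.ncard := by
    have : Nonempty V := ⟨x⟩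
    choose! g hg using hdeg
    have h1 : ((Finset.Icc (4 * r) (8 * r)).image g : Set V) ⊆ T := by
      intro y hy
      simp only [Finset.coe_image, Set.mem_image, Finset.mem_coe, Finset.mem_Icc] at hy
      obtain ⟨j, ⟨hj1, hj2⟩, rfl⟩ := hy
      change 4 * r ≤ d (g j)
      rw [hg j (by omega) hj2]
      exact hj1
    have h2 := Set.ncard_le_ncard h1 (Set.toFinite _)
    rw [Set.ncard_coe_finset, Finset.card_image_of_injOn, Nat.card_Icc] at h2
    · omega
    · intro i hi j hj hij
      rw [Finset.mem_coe, Finset.mem_Icc] at hi hj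
      rw [← hg i (by omega) hi.2, ← hg j (by omega) hj.2, hij]
  -- `S` and `T` both consist of nodes of highest degree, hence one contains the other; each has at
  -- least `4 * r` elements.
  have hST : r ≤ (S ∩ T).ncard := by
    by_cases h : S ⊆ T
    · rw [Set.inter_eq_left.2 h]; omega
    · obtain ⟨y, hyS, hyT⟩ := Set.not_subset.1 h
      have : T ⊆ S := by
        intro z hz
        by_contra hzS
        have h1 := hS.highest y hyS z hzS
        exact hyT (le_trans (show 4 * r ≤ d z from hz) h1)
      rw [Set.inter_eq_right.2 this]; omega
  obtain ⟨U, hU, hUr⟩ := Set.exists_subset_card_eq hST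
  have hUf : Nat.card U = r := hUr
  let e : Fin r ≃ U := (Finite.equivFinOfCardEq hUf).symm
  -- A centre has degree at least `4 * r`, so at least `2 * r` neighbours in `S`; discarding the `r`
  -- centres leaves at least `r` leaves.
  have hlv : ∀ i : Fin r, ∃ w : Fin r → V, Function.Injective w ∧
      ∀ p, w p ∈ (G.neighborSet (e i) ∩ S) \ U := by
    intro i
    have h1 := hS.dense (e i) (hU (e i).2).1
    have h2 : 4 * r ≤ (G.neighborSet (e i)).ncard := (hU (e i).2).2
    have h3 := Set.le_ncard_sdiff U (G.neighborSet (e i) ∩ S)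
    obtain ⟨W, hW, hWr⟩ := Set.exists_subset_card_eq (s := (G.neighborSet (e i) ∩ S) \ U) (n := r)
      (by omega)
    have hWf : Nat.card W = r := hWr
    refine ⟨fun p => ((Finite.equivFinOfCardEq hWf).symm p : W), ?_, fun p => hW (Subtype.prop _)⟩
    exact Subtype.val_injective.comp (Equiv.injective _)
  choose v hv1 hv2 using hlv
  refine ⟨fun i => e i, v, Subtype.val_injective.comp e.injective, hv1, ?_,
    fun i => (hU (e i).2).1, fun i p => (hv2 i p).1.2, fun i p => (hv2 i p).1.1⟩
  intro i p i' h
  exact (hv2 i p).2 (h ▸ (e i').2)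

/-- The edges of a star system of a subgraph embedded by `f`. -/
def starEdge {V W I K : Type*} (f : V → W) (u : I → V) (v : I → K → V) (p : I × K) : Sym2 W :=
  s(f (u p.1), f (v p.1 p.2))

theorem IsStarSystem.starEdge_injective {V W I K : Type*} {G : SimpleGraph V} {S : Set V}
    {u : I → V} {v : I → K → V} (h : IsStarSystem G S u v) {f : V → W}
    (hf : Function.Injective f) : Function.Injective (starEdge f u v) := by
  intro x y heq
  rw [starEdge, starEdge, Sym2.eq_iff] at heq
  rcases heq with ⟨h1, h2⟩ | ⟨h1, h2⟩
  · have hi : x.1 = y.1 := h.center_injective (hf h1)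
    rw [hi] at h2
    exact Prod.ext hi (h.leaf_injective _ (hf h2))
  · exact absurd (hf h2) (h.leaf_ne _ _ _)

/-! ### From stars in the reservoir to detecting components -/

/-- A reservoir that contains a star with `h` nodes in `S` detects `S`. -/
theorem IsStarSystem.exists_largeComponent {V W I B J : Type*} [Finite W] [Fintype B]
    {G : SimpleGraph V} {S : Set V} {u : I → V} {v : I → B × J → V} (hst : IsStarSystem G S u v)
    {f : V → W} (hf : Function.Injective f) {h : ℕ} (hB : h ≤ Fintype.card B + 1)
    {R : Finset (Sym2 W)} (hR : MeetsBlock (starEdge f u v) R) :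
    ∃ x ∈ S, ∃ C ∈ largeComponents h R,
      C = ((reservoirGraph R).connectedComponentMk (f x)).supp ∧
      ∃ T : Set W, T ⊆ C ∩ f '' S ∧ h ≤ T.ncard ∧ ((reservoirGraph R).induce T).Connected := by
  obtain ⟨i, hi⟩ := hR
  choose j hj using hi
  -- A substar: `none` is the centre, and each part contributes one leaf.
  set g : Option B → W := fun o => o.elim (f (u i)) fun b => f (v i (b, j b)) with hg
  have hginj : Function.Injective g := by
    rintro (_ | b) (_ | b') ho
    · rfl
    · exact absurd (hf ho).symm (hst.leaf_ne _ _ _)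
    · exact absurd (hf ho) (hst.leaf_ne _ _ _)
    · have := hst.leaf_injective i (hf ho)
      rw [Prod.mk.injEq] at this
      rw [this.1]
  have hadj : ∀ b, (reservoirGraph R).Adj (g none) (g (some b)) := by
    intro b
    rw [reservoirGraph, SimpleGraph.fromEdgeSet_adj]
    refine ⟨hj b, fun h => ?_⟩
    simpa using hginj h
  have hcard : (Set.range g).ncard = Fintype.card B + 1 := by
    rw [← Set.image_univ, Set.ncard_image_of_injective _ hginj, Set.ncard_univ,
      Nat.card_eq_fintype_card, Fintype.card_option]
  have hsub : Set.range g ⊆ ((reservoirGraph R).connectedComponentMk (f (u i))).supp := by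
    rintro _ ⟨o, rfl⟩
    rw [SimpleGraph.ConnectedComponent.mem_supp_iff, SimpleGraph.ConnectedComponent.eq]
    cases o with
    | none => exact SimpleGraph.Reachable.refl _
    | some b => exact (hadj b).symm.reachable
  refine ⟨u i, hst.center_mem i, _, ⟨⟨_, rfl⟩, ?_⟩, rfl, Set.range g, ?_, hcard.symm ▸ hB, ?_⟩
  · exact hB.trans (hcard ▸ Set.ncard_le_ncard hsub (Set.toFinite _))
  · refine Set.subset_inter hsub ?_
    rintro _ ⟨o, rfl⟩
    cases o with
    | none => exact ⟨_, hst.center_mem i, rfl⟩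
    | some b => exact ⟨_, hst.leaf_mem i _, rfl⟩
  · rw [SimpleGraph.connected_iff_exists_forall_reachable]
    refine ⟨⟨g none, none, rfl⟩, ?_⟩
    rintro ⟨_, o, rfl⟩
    cases o with
    | none => exact SimpleGraph.Reachable.refl _
    | some b => exact SimpleGraph.Adj.reachable (hadj b)

/-- If the reservoir has no joining edges, its components do not cross between the two parts. -/
theorem isLeft_eq_of_reachable {V₁ V₂ : Type*} {G₁ : SimpleGraph V₁} {G₂ : SimpleGraph V₂}
    {R : Finset (Sym2 (V₁ ⊕ V₂))} (hR : (R : Set (Sym2 (V₁ ⊕ V₂))) ⊆ (G₁ ⊕g G₂).edgeSet)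
    {x y : V₁ ⊕ V₂} (hxy : (reservoirGraph R).Reachable x y) : x.isLeft = y.isLeft := by
  obtain ⟨p⟩ := hxy
  induction p with
  | nil => rfl
  | @cons a b c hab _ ih =>
    rw [← ih]
    rw [reservoirGraph, SimpleGraph.fromEdgeSet_adj] at hab
    have := hR hab.1
    rw [SimpleGraph.mem_edgeSet] at this
    cases a <;> cases b <;> simp_all

/-! ### Counting edges -/

theorem ncard_edgeSet_sum {V₁ V₂ : Type*} [Finite V₁] [Finite V₂] (G₁ : SimpleGraph V₁)
    (G₂ : SimpleGraph V₂) :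
    (G₁ ⊕g G₂).edgeSet.ncard = G₁.edgeSet.ncard + G₂.edgeSet.ncard := by
  rw [← Nat.card_coe_set_eq, ← Nat.card_coe_set_eq, ← Nat.card_coe_set_eq, ← Nat.card_sum]
  exact Nat.card_congr SimpleGraph.edgeSetSumEquiv

theorem ncard_edgeSet_joinGraph_le {V₁ V₂ : Type*} [Finite V₁] [Finite V₂] (G₁ : SimpleGraph V₁)
    (G₂ : SimpleGraph V₂) (F : Finset (V₁ × V₂)) :
    (joinGraph G₁ G₂ F).edgeSet.ncard ≤ (G₁ ⊕g G₂).edgeSet.ncard + F.card := by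
  classical
  rw [joinGraph, SimpleGraph.edgeSet_sup]
  refine (Set.ncard_union_le _ _).trans (Nat.add_le_add_left ?_ _)
  refine le_trans (Set.ncard_le_ncard (t := (F.image fun p => s(Sum.inl p.1, Sum.inr p.2) :
    Finset (Sym2 (V₁ ⊕ V₂)))) ?_ (Set.toFinite _)) ?_
  · rw [SimpleGraph.edgeSet_fromEdgeSet]
    rintro e ⟨⟨p, hp, rfl⟩, -⟩
    simp only [Finset.coe_image, Set.mem_image, Finset.mem_coe]
    exact ⟨p, hp, rfl⟩
  · rw [Set.ncard_coe_finset]; exact Finset.card_image_le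

-- With a common bound `N` for two graphs of the same distribution, both formulas agree, so the
-- graphs have equally many nodes and edges.
open Finset in
theorem two_mul_ncard_edgeSet_eq {V : Type*} [Fintype V] {G : SimpleGraph V} {D : ℕ → ℕ}
    (hD : HasDegreeDistribution G D) (N : ℕ) (hN : Fintype.card V ≤ N) :
    2 * G.edgeSet.ncard = ∑ j ∈ Icc 1 N, j * D j ∧ Fintype.card V = ∑ j ∈ Icc 1 N, D j := by
  classical
  have hdeg : ∀ v, (G.neighborSet v).ncard = G.degree v := fun v => by
    rw [← SimpleGraph.card_neighborSet_eq_degree, ← Nat.card_eq_fintype_card]; rfl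
  have hDj : ∀ j, D j = #{v | G.degree v = j} := fun j => by
    rw [← hD.2 j]
    simp_rw [hdeg]
    rw [← Set.ncard_coe_finset]; congr 1; ext; simp
  have hmem : ∀ v ∈ (univ : Finset V), G.degree v ∈ Icc 1 N := by
    intro v _
    rw [mem_Icc]
    constructor
    · by_contra h
      have h0 : G.degree v = 0 := by omega
      have := hD.1
      rw [hDj 0, card_eq_zero] at this
      have hv : v ∈ ({v | G.degree v = 0} : Finset V) := by simpa using h0
      rw [this] at hv
      simp at hv
    · exact (G.degree_lt_card_verts v).le.trans hN
  constructor
  · have h1 := G.sum_degrees_eq_twice_card_edges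
    have h2 : G.edgeSet.ncard = #G.edgeFinset := by
      rw [← SimpleGraph.coe_edgeFinset, Set.ncard_coe_finset]
    rw [h2, ← h1, ← sum_fiberwise_of_maps_to hmem]
    refine sum_congr rfl fun j _ => ?_
    rw [hDj j, mul_comm, ← smul_eq_mul, ← sum_const]
    exact sum_congr rfl fun v hv => (mem_filter.1 hv).2
  · rw [← card_univ, card_eq_sum_card_fiberwise hmem]
    exact sum_congr rfl fun j _ => (hDj j).symm

/-- The degree sum is at most `L * n` times the harmonic sum `∑ 1 / j`. -/
theorem two_mul_ncard_edgeSet_le {V : Type*} [Fintype V] {G : SimpleGraph V} {D : ℕ → ℕ} {L : ℝ}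
    (hL : 1 ≤ L) (hD : HasDegreeDistribution G D) (hpl : IsPowerLaw L (Nat.card V) D) :
    (2 * G.edgeSet.ncard : ℝ) ≤
      L * Fintype.card V * (1 + Real.log (Fintype.card V)) := by
  have h := (two_mul_ncard_edgeSet_eq hD _ le_rfl).1
  have h' : (2 * G.edgeSet.ncard : ℝ) = ∑ j ∈ Finset.Icc 1 (Fintype.card V), (j : ℝ) * D j := by
    exact_mod_cast h
  rw [h']
  have hh := harmonic_le_one_add_log (Fintype.card V)
  rw [harmonic_eq_sum_Icc] at hh
  push_cast at hh
  refine le_trans ?_ (mul_le_mul_of_nonneg_left hh (by positivity))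
  rw [Finset.mul_sum]
  refine Finset.sum_le_sum fun j hj => ?_
  rw [Finset.mem_Icc] at hj
  have hj0 : (0 : ℝ) < j := by exact_mod_cast hj.1
  have h1 := (hpl j hj.1).1
  rw [Nat.card_eq_fintype_card] at h1
  calc (j : ℝ) * D j ≤ j * (L * Fintype.card V / (j : ℝ) ^ 2) := by gcongr
    _ = L * Fintype.card V * (j : ℝ)⁻¹ := by field_simp

theorem two_mul_ncard_edgeSet_le_sq {V : Type*} [Fintype V] (G : SimpleGraph V) :
    2 * G.edgeSet.ncard ≤ Fintype.card V ^ 2 := by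
  classical
  have h1 := G.sum_degrees_eq_twice_card_edges
  have h2 : G.edgeSet.ncard = G.edgeFinset.card := by
    rw [← SimpleGraph.coe_edgeFinset, Set.ncard_coe_finset]
  rw [h2, ← h1, sq, ← smul_eq_mul, ← Finset.card_univ, ← Finset.sum_const]
  exact Finset.sum_le_sum fun v _ => (G.degree_lt_card_verts v).le

/-! ### Asymptotic estimates -/

theorem one_sub_pow_le_inv {p : ℝ} (h0 : 0 ≤ p) (h1 : p ≤ 1) (q : ℕ) :
    (1 - p) ^ q ≤ (1 + q * p)⁻¹ := by
  have hq : 0 < 1 + q * p := by positivity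
  rw [← one_div, le_div_iff₀ hq]
  have h2 : 1 + q * p ≤ (1 + p) ^ q := one_add_mul_le_pow (by linarith) q
  have h3 : 0 ≤ (1 - p) ^ q := pow_nonneg (by linarith) q
  calc (1 - p) ^ q * (1 + q * p) ≤ (1 - p) ^ q * (1 + p) ^ q := by gcongr
    _ = (1 - p ^ 2) ^ q := by rw [← mul_pow]; ring
    _ ≤ 1 := pow_le_one₀ (by nlinarith) (by nlinarith)

theorem eventually_mul_one_add_log_pow_le (K : ℝ) (l : ℕ) :
    ∀ᶠ n : ℕ in Filter.atTop, K * (1 + Real.log n) ^ l ≤ n := by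
  -- The factor `e` absorbs the summand: `1 + log n = log (e * n)`.
  have h1 : Filter.Tendsto (fun n : ℕ => Real.exp 1 * (n : ℝ)) Filter.atTop Filter.atTop :=
    tendsto_natCast_atTop_atTop.const_mul_atTop (Real.exp_pos 1)
  have h2 := ((Real.isLittleO_pow_log_id_atTop (n := l)).comp_tendsto h1).def
    (c := (Real.exp 1 * (|K| + 1))⁻¹) (by positivity)
  filter_upwards [h2, Filter.eventually_ge_atTop 1] with n hn hn1
  have hn0 : (1 : ℝ) ≤ n := by exact_mod_cast hn1
  have hlog : 0 ≤ Real.log n := Real.log_nonneg hn0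
  simp only [Function.comp_apply, id] at hn
  rw [Real.log_mul (Real.exp_pos 1).ne' (by positivity), Real.log_exp,
    Real.norm_of_nonneg (by positivity), Real.norm_of_nonneg (by positivity), mul_inv,
    show (Real.exp 1)⁻¹ * (|K| + 1)⁻¹ * (Real.exp 1 * (n : ℝ)) = (|K| + 1)⁻¹ * n by
      field_simp] at hn
  have h3 : (1 + Real.log n) ^ l * (|K| + 1) ≤ n := by
    have := mul_le_mul_of_nonneg_left hn (by positivity : 0 ≤ |K| + 1)
    rw [← mul_assoc, mul_inv_cancel₀ (by positivity), one_mul] at this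
    linarith
  have h4 : 0 ≤ (1 + Real.log n) ^ l := by positivity
  nlinarith [le_abs_self K]

/-- The number of stars found in a community of a power law graph with `n` nodes, which is also
the number of their leaves. -/
def starCount (L : ℝ) (n : ℕ) : ℕ := ⌊√(n / L)⌋₊ / 8

theorem mul_starCount_sq_le {L : ℝ} (hL : 1 ≤ L) (n : ℕ) :
    L * (8 * starCount L n : ℝ) ^ 2 ≤ n := by
  have hL0 : 0 < L := by linarith
  have h1 : (8 * starCount L n : ℝ) ≤ √(n / L) := by
    have h2 : 8 * starCount L n ≤ ⌊√(n / L)⌋₊ := Nat.mul_div_le _ _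
    have h3 : ((8 * starCount L n : ℕ) : ℝ) ≤ ⌊√(n / L)⌋₊ := by exact_mod_cast h2
    push_cast at h3
    exact h3.trans (Nat.floor_le (Real.sqrt_nonneg _))
  calc L * (8 * starCount L n : ℝ) ^ 2 ≤ L * √(n / L) ^ 2 := by gcongr
    _ = (n : ℝ) := by rw [Real.sq_sqrt (by positivity)]; field_simp

theorem eventually_le_starCount {L : ℝ} (hL : 1 ≤ L) (r : ℕ) :
    ∀ᶠ n : ℕ in Filter.atTop, r ≤ starCount L n := by
  have hL0 : 0 < L := by linarith
  have h : Filter.Tendsto (starCount L) Filter.atTop Filter.atTop :=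
    (Nat.tendsto_div_const_atTop (by norm_num)).comp (tendsto_nat_floor_atTop.comp
      (Real.tendsto_sqrt_atTop.comp (tendsto_natCast_atTop_atTop.atTop_div_const hL0)))
  exact h.eventually_ge_atTop r

/-- Rounding loses at most a factor two: `√(n / L) < 8 * r + 8 ≤ 16 * r` for `r = starCount L n ≥
1`. -/
theorem div_le_starCount {L : ℝ} (hL : 1 ≤ L) {n : ℕ} (h : 1 ≤ starCount L n) :
    √n / (16 * L) ≤ starCount L n := by
  have hL0 : 0 < L := by linarith
  have h1 : ⌊√(n / L)⌋₊ < 8 * starCount L n + 8 := by unfold starCount; omega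
  have h2 : √(n / L) < ((8 * starCount L n + 8 : ℕ) : ℝ) := (Nat.floor_lt (Real.sqrt_nonneg _)).1 h1
  have h3 : (1 : ℝ) ≤ starCount L n := by exact_mod_cast h
  push_cast at h2
  have h4 : √n / L ≤ √(n / L) := by
    rw [Real.sqrt_div (Nat.cast_nonneg n)]
    refine div_le_div_of_nonneg_left (Real.sqrt_nonneg _) (Real.sqrt_pos.2 hL0) ?_
    exact Real.sqrt_le_iff.2 ⟨hL0.le, by nlinarith⟩
  rw [show √(n : ℝ) / (16 * L) = √n / L / 16 by field_simp]
  linarith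

/-- If `n` is large, the stars in a community are so numerous and large that a random reservoir
of about `a √m` edges contains a substar with `l` leaves. -/
theorem eventually_blocks_le {L a : ℝ} (hL : 1 ≤ L) (ha : 0 < a) (ha1 : a ≤ 1) (l : ℕ) :
    ∀ᶠ n : ℕ in Filter.atTop, ∀ m k : ℕ, 1 ≤ m → (2 * m : ℝ) ≤ L * n * (1 + Real.log n) →
      a * √m ≤ k → ∃ M : ℕ, 0 < M ∧ 4 * (2 * m) ≤ k * M ∧
        (1 - (1 - (1 - 1 / (M : ℝ)) ^ (starCount L n / (l + 1))) ^ l) ^ starCount L n ≤ 1 / 8 := by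
  have hL0 : 0 < L := by linarith
  -- Combines the bounds `hqn` on the part size, `hMle` on the number of colours and `hsmn` on `√m`,
  -- so that a part contains at least `c / g` coloured edges on average, with `g = √(1 + log n)`.
  set c : ℝ := a / (32 * (l + 1) * 9 * L ^ 2) with hc
  have hc0 : 0 < c := by positivity
  have hc1 : c ≤ 1 := by
    rw [hc, div_le_one (by positivity)]
    have : (1 : ℝ) ≤ L ^ 2 := by nlinarith
    have hl : (0 : ℝ) ≤ l := Nat.cast_nonneg l
    nlinarith [mul_nonneg hl (by positivity : 0 ≤ L ^ 2)]
  filter_upwards [eventually_le_starCount hL (2 * (l + 1)), Filter.eventually_ge_atTop 1,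
    eventually_mul_one_add_log_pow_le ((7 * (16 * L) / (c / 2) ^ l) ^ 2) l]
    with n hr hn1 hlog m k hm hmn hk
  set r := starCount L n 
  set q := r / (l + 1) with hq
  have hm0 : (1 : ℝ) ≤ m := by exact_mod_cast hm
  have hsm : 1 ≤ √(m : ℝ) := Real.one_le_sqrt.2 hm0
  have hk0 : 0 < (k : ℝ) := lt_of_lt_of_le (by positivity) hk
  have hn0 : (1 : ℝ) ≤ n := by exact_mod_cast hn1
  have hln : 0 ≤ Real.log n := Real.log_nonneg hn0
  set g : ℝ := √(1 + Real.log n) with hg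
  have hg1 : 1 ≤ g := Real.one_le_sqrt.2 (by linarith)
  have hrn : √n / (16 * L) ≤ r := div_le_starCount hL (by omega)
  have hqn : √n / (32 * (l + 1) * L) ≤ q := by
    have h1 : r < (l + 1) * (q + 1) := by
      have := Nat.lt_mul_div_succ r (Nat.succ_pos l)
      simpa using this
    have h2 : 2 ≤ q := (Nat.le_div_iff_mul_le (Nat.succ_pos l)).2 hr
    have h3 : r ≤ (l + 1) * (2 * q) := h1.le.trans (Nat.mul_le_mul_left _ (by omega))
    have h4 : (r : ℝ) ≤ (l + 1) * (2 * q) := by exact_mod_cast h3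
    rw [div_le_iff₀ (by positivity)]
    rw [div_le_iff₀ (by positivity)] at hrn
    calc √(n : ℝ) ≤ r * (16 * L) := hrn
      _ ≤ (l + 1) * (2 * q) * (16 * L) := by gcongr
      _ = _ := by ring
  -- The least number of colours with `8 * m ≤ k * M`, as Markov's inequality requires.
  refine ⟨⌈8 * (m : ℝ) / k⌉₊, Nat.ceil_pos.2 (by positivity), ?_, ?_⟩
  · have h1 : 8 * (m : ℝ) / k ≤ ⌈8 * (m : ℝ) / k⌉₊ := Nat.le_ceil _
    rw [div_le_iff₀ hk0] at h1
    have h2 : ((4 * (2 * m) : ℕ) : ℝ) ≤ ((k * ⌈8 * (m : ℝ) / k⌉₊ : ℕ) : ℝ) := by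
      push_cast; linarith
    exact_mod_cast h2
  set M := ⌈8 * (m : ℝ) / k⌉₊ with hM
  have hM0 : 0 < M := Nat.ceil_pos.2 (by positivity)
  have hM0' : (1 : ℝ) ≤ M := by exact_mod_cast hM0
  have hMle : (M : ℝ) ≤ 9 * √m / a := by
    have h1 : (M : ℝ) < 8 * (m : ℝ) / k + 1 := Nat.ceil_lt_add_one (by positivity)
    have h2 : 8 * (m : ℝ) / k ≤ 8 * √m / a := by
      rw [div_le_div_iff₀ hk0 ha]
      have h3 : √(m : ℝ) * √m = m := Real.mul_self_sqrt (by positivity)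
      calc 8 * (m : ℝ) * a = 8 * √m * (a * √m) := by linear_combination (-8 * a) * h3
        _ ≤ 8 * √m * k := by gcongr
    have h3 : 1 ≤ √(m : ℝ) / a := by rw [le_div_iff₀ ha]; linarith
    have h4 : 9 * √(m : ℝ) / a = 8 * √m / a + √m / a := by ring
    linarith
  have hsmn : √(m : ℝ) ≤ L * √n * g := by
    refine Real.sqrt_le_iff.2 ⟨by positivity, ?_⟩
    rw [mul_pow, mul_pow, Real.sq_sqrt (by positivity), hg, Real.sq_sqrt (by positivity)]
    have h1 : L * n * (1 + Real.log n) ≤ L ^ 2 * n * (1 + Real.log n) := by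
      have : L ≤ L ^ 2 := by nlinarith
      gcongr
    linarith
  have hsn : 0 < √(n : ℝ) := Real.sqrt_pos.2 (by linarith)
  have hy : c / g ≤ q * (1 / (M : ℝ)) := by
    have h1 : (M : ℝ) ≤ 9 * (L * √n * g) / a := hMle.trans (by gcongr)
    calc c / g = √n / (32 * (l + 1) * L) * (1 / (9 * (L * √n * g) / a)) := by
          rw [hc]; field_simp
      _ ≤ q * (1 / (M : ℝ)) := by gcongr
  have hg0 : 0 < g := by linarith
  have hy1 : c / g ≤ 1 := by rw [div_le_one hg0]; linarith
  have hy0 : 0 < c / g := by positivity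
  have hp1 : 1 / (M : ℝ) ≤ 1 := by rw [div_le_one (by linarith)]; exact hM0'
  have hp0 : 0 ≤ 1 / (M : ℝ) := by positivity
  have hpart : c / g / 2 ≤ 1 - (1 - 1 / (M : ℝ)) ^ q := by
    have h1 := one_sub_pow_le_inv hp0 hp1 q
    have h2 : (1 + q * (1 / (M : ℝ)))⁻¹ ≤ (1 + c / g)⁻¹ := by gcongr
    have h3 : (1 + c / g)⁻¹ ≤ 1 - c / g / 2 := by
      rw [inv_le_iff_one_le_mul₀ (by positivity)]
      nlinarith
    linarith
  have hpart1 : 1 - (1 - 1 / (M : ℝ)) ^ q ≤ 1 := by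
    have : 0 ≤ (1 - 1 / (M : ℝ)) ^ q := pow_nonneg (by linarith) _
    linarith
  set P := (1 - (1 - 1 / (M : ℝ)) ^ q) ^ l with hP
  have hPge : (c / g / 2) ^ l ≤ P := pow_le_pow_left₀ (by positivity) hpart l
  have hP0 : 0 ≤ P := le_trans (by positivity) hPge
  have hP1 : P ≤ 1 := pow_le_one₀ (le_trans (by positivity) hpart) hpart1
  -- The expected number of good stars; it bounds the failure probability by `1 / (1 + 7)`.
  have hrP : 7 ≤ r * P := by
    have h1 : 7 * (16 * L) / (c / 2) ^ l * g ^ l ≤ √n := by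
      refine Real.le_sqrt_of_sq_le ?_
      rw [mul_pow, ← pow_mul, mul_comm l 2, pow_mul, hg, Real.sq_sqrt (by positivity)]
      exact hlog
    calc (7 : ℝ) = 7 * (16 * L) / (c / 2) ^ l * g ^ l / (16 * L) * (c / g / 2) ^ l := by
          rw [div_right_comm c g, div_pow _ g]
          field_simp
      _ ≤ √n / (16 * L) * P := by gcongr
      _ ≤ r * P := by gcongr
  refine (one_sub_pow_le_inv hP0 hP1 r).trans ?_
  rw [inv_le_comm₀ (by positivity) (by norm_num)]
  linarith

/-! ### Positive density of the good edge sets -/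

/-- Each further element multiplies the binomial coefficient by `(N + b + 1) / (N + b + 1 - k) ≤ 2`.
This prices the exclusion of the joining edges. -/
theorem choose_add_le_two_pow_mul {N k : ℕ} (h : 2 * k ≤ N) (b : ℕ) :
    (N + b).choose k ≤ 2 ^ b * N.choose k := by
  induction b with
  | zero => simp
  | succ b ih =>
    have h1 := Nat.choose_mul_succ_eq (N + b) k
    have h2 : (N + b + 1).choose k * (N + b + 1) ≤ 2 * (N + b).choose k * (N + b + 1) := by
      calc (N + b + 1).choose k * (N + b + 1) ≤
            (N + b + 1).choose k * (2 * (N + b + 1 - k)) := Nat.mul_le_mul_left _ (by omega)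
        _ = 2 * ((N + b + 1).choose k * (N + b + 1 - k)) := by ring
        _ = _ := by rw [← h1]; ring
    have h3 := Nat.le_of_mul_le_mul_right h2 (Nat.succ_pos _)
    rw [← add_assoc, pow_succ]
    calc _ ≤ 2 * (N + b).choose k := h3
      _ ≤ 2 * (2 ^ b * N.choose k) := Nat.mul_le_mul_left _ ih
      _ = _ := by ring

open Finset Classical in
/-- A set of `2 * m` edges that contains two systems of stars: among its `k`-subsets, those which
contain a substar of each system have a positive density. -/
theorem choose_le_mul_card_meetsBlock {L : ℝ} {l n m k M : ℕ} {α : Type*} [Fintype α]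
    {X : Finset α} (hX : #X = 2 * m) (hm : 1 ≤ m)
    {φ₁ φ₂ : Fin (starCount L n) × Fin l × Fin (starCount L n / (l + 1)) → α}
    (hφ₁ : Function.Injective φ₁) (hφ₂ : Function.Injective φ₂) (hX₁ : ∀ p, φ₁ p ∈ X)
    (hX₂ : ∀ p, φ₂ p ∈ X) (hn : l + 1 ≤ starCount L n) (hlk : 2 * l ≤ k) (hkm : k ≤ 2 * m)
    (hlarge : M ≤ m → ∃ k₀ M' : ℕ, k₀ ≤ k ∧ 0 < M' ∧ 4 * (2 * m) ≤ k₀ * M' ∧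
      (1 - (1 - (1 - 1 / (M' : ℝ)) ^ (starCount L n / (l + 1))) ^ l) ^ starCount L n ≤ 1 / 8) :
    (2 * m).choose k ≤
      2 ^ (2 * M + 1) * #{T ∈ powersetCard k X | MeetsBlock φ₁ T ∧ MeetsBlock φ₂ T} := by
  rcases le_or_gt M m with hMm | hMm
  · obtain ⟨k₀, M', hk₀, hM', h1, h2⟩ := hlarge hMm
    have h3 := choose_le_two_mul_card_meetsBlock φ₁ hφ₁ φ₂ hφ₂ X hX₁ hX₂ (by omega) k M' hM'
      (by rw [hX]; exact h1.trans (Nat.mul_le_mul_right _ hk₀))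
      (by simpa only [Fintype.card_fin] using h2) (by simpa only [Fintype.card_fin] using h2)
    rw [hX] at h3
    refine h3.trans (Nat.mul_le_mul_right _ ?_)
    calc 2 = 2 ^ 1 := rfl
      _ ≤ _ := Nat.pow_le_pow_right (by norm_num) (by omega)
  -- For `m < M` a single good set suffices, as there are at most `2 ^ (2 * m)` subsets: take `l`
  -- edges of one star in each system, which fit since `2 * l ≤ k`, and fill up.
  · have hr : 0 < starCount L n := by omega
    have hq : 0 < starCount L n / (l + 1) := Nat.div_pos hn (Nat.succ_pos l)
    have hmeet : ∀ φ : Fin (starCount L n) × Fin l × Fin (starCount L n / (l + 1)) → α,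
        MeetsBlock φ (univ.image fun b => φ (⟨0, hr⟩, b, ⟨0, hq⟩)) := fun φ =>
      ⟨⟨0, hr⟩, fun b => ⟨⟨0, hq⟩, mem_image_of_mem _ (mem_univ b)⟩⟩
    obtain ⟨T, hT1, hT2, hT3⟩ := exists_subsuperset_card_eq
      (s := (univ.image fun b => φ₁ (⟨0, hr⟩, b, ⟨0, hq⟩)) ∪
        (univ.image fun b => φ₂ (⟨0, hr⟩, b, ⟨0, hq⟩))) (t := X) (n := k)
      (by
        intro x hx
        simp only [mem_union, mem_image, mem_univ, true_and] at hx
        rcases hx with ⟨b, rfl⟩ | ⟨b, rfl⟩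
        · exact hX₁ _
        · exact hX₂ _)
      (by
        refine (card_union_le _ _).trans ?_
        have h1 := card_image_le (s := univ) (f := fun b => φ₁ (⟨0, hr⟩, b, ⟨0, hq⟩))
        have h2 := card_image_le (s := univ) (f := fun b => φ₂ (⟨0, hr⟩, b, ⟨0, hq⟩))
        rw [card_univ, Fintype.card_fin] at h1 h2
        omega)
      (by omega)
    have hpos : 0 < #{T ∈ powersetCard k X | MeetsBlock φ₁ T ∧ MeetsBlock φ₂ T} := by
      refine card_pos.2 ⟨T, ?_⟩
      rw [mem_filter, mem_powersetCard]
      exact ⟨⟨hT2, hT3⟩, (hmeet φ₁).mono (subset_union_left.trans hT1),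
        (hmeet φ₂).mono (subset_union_right.trans hT1)⟩
    calc (2 * m).choose k ≤ 2 ^ (2 * m) := Nat.choose_le_two_pow _ _
      _ ≤ 2 ^ (2 * M + 1) := Nat.pow_le_pow_right (by norm_num) (by omega)
      _ ≤ _ := Nat.le_mul_of_pos_right _ hpos

/-! ### Assembling the theorem -/

theorem ofReal_le_mul_inv {C b N : ℕ} (hC : 0 < C) (hN : N ≤ C * b) (hN0 : 0 < N) :
    ENNReal.ofReal ((C : ℝ)⁻¹) ≤ (b : ENNReal) * (N : ENNReal)⁻¹ := by
  have hC0 : (C : ENNReal) ≠ 0 := by exact_mod_cast hC.ne'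
  have hN0' : (N : ENNReal) ≠ 0 := by exact_mod_cast hN0.ne'
  rw [ENNReal.ofReal_inv_of_pos (by exact_mod_cast hC), ENNReal.ofReal_natCast, ← div_eq_mul_inv,
    ENNReal.le_div_iff_mul_le (Or.inl hN0') (Or.inl (ENNReal.natCast_ne_top _)),
    ENNReal.inv_mul_le_iff hC0 (ENNReal.natCast_ne_top _)]
  exact_mod_cast hN

/-- Each community of a `D(δ)²` graph contains a system of stars. -/
theorem IsDSquared.exists_isStarSystem {V₁ V₂ : Type*} [Fintype V₁] [Fintype V₂] {L A : ℝ}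
    (hL : 1 ≤ L) {B : ℕ} {D : ℕ → ℕ} {G₁ : SimpleGraph V₁} {G₂ : SimpleGraph V₂}
    {F : Finset (V₁ × V₂)} {S₁ : Set V₁} {S₂ : Set V₂} (h : IsDSquared L A B D G₁ G₂ F S₁ S₂)
    (l : ℕ) :
    (∃ (u : Fin (starCount L (Fintype.card V₁)) → V₁)
      (v : Fin (starCount L (Fintype.card V₁)) →
        Fin l × Fin (starCount L (Fintype.card V₁) / (l + 1)) → V₁), IsStarSystem G₁ S₁ u v) ∧
    ∃ (u : Fin (starCount L (Fintype.card V₁)) → V₂)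
      (v : Fin (starCount L (Fintype.card V₁)) →
        Fin l × Fin (starCount L (Fintype.card V₁) / (l + 1)) → V₂), IsStarSystem G₂ S₂ u v := by
  have hcard : Fintype.card V₂ = Fintype.card V₁ := by
    have h1 := (two_mul_ncard_edgeSet_eq h.dist₁ _ (le_max_left _ (Fintype.card V₂))).2
    have h2 := (two_mul_ncard_edgeSet_eq h.dist₂ _ (le_max_right (Fintype.card V₁) _)).2
    rw [h2, ← h1]
  set r := starCount L (Fintype.card V₁) with hr
  have hLr := mul_starCount_sq_le hL (Fintype.card V₁)
  rw [← hr] at hLr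
  -- The divisor `l + 1`, instead of `l`, keeps the parts nonempty when `l = 0` and `r > 0`.
  have hq : l * (r / (l + 1)) ≤ r :=
    (Nat.mul_le_mul_right _ (Nat.le_succ l)).trans (Nat.mul_div_le r (l + 1))
  let g : Fin l × Fin (r / (l + 1)) → Fin r := fun p => Fin.castLE hq (finProdFinEquiv p)
  have hg : Function.Injective g := (Fin.castLE_injective hq).comp finProdFinEquiv.injective
  constructor
  · obtain ⟨u, v, huv⟩ := _root_.exists_isStarSystem hL h.dist₁ h.powerLaw h.community₁ r
      (by rwa [Nat.card_eq_fintype_card])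
    exact ⟨u, _, huv.comp g hg⟩
  · have hpl := h.powerLaw
    rw [Nat.card_eq_fintype_card, ← hcard, ← Nat.card_eq_fintype_card] at hpl
    obtain ⟨u, v, huv⟩ := _root_.exists_isStarSystem hL h.dist₂ hpl h.community₂ r
      (by rwa [Nat.card_eq_fintype_card, hcard])
    exact ⟨u, _, huv.comp g hg⟩

open Finset Classical in
theorem mainTheorem2 (L A : ℝ) (hL : 1 ≤ L) (B h : ℕ) :
    ∃ m₀ : ℕ, ∀ a : ℝ, 0 < a → ∃ δ : ℝ, 0 < δ ∧
      ∀ (V₁ V₂ : Type*) [Fintype V₁] [Fintype V₂]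
        (D : ℕ → ℕ) (G₁ : SimpleGraph V₁) (G₂ : SimpleGraph V₂) (F : Finset (V₁ × V₂))
        (S₁ : Set V₁) (S₂ : Set V₂),
        IsDSquared L A B D G₁ G₂ F S₁ S₂ →
        ∀ m : ℕ, G₁.edgeSet.ncard = m → m₀ ≤ m →
        ∀ s : List (Sym2 (V₁ ⊕ V₂)), IsEdgeStream (joinGraph G₁ G₂ F) s →
        ∀ k c : ℕ, 2 * h ≤ k + 2 → a * √(m : ℝ) ≤ k →
          ENNReal.ofReal δ ≤
              (dcAlgorithm k c h s).toOuterMeasure {st | DetectsBoth h S₁ S₂ st} ∧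
            (k ≤ m →
              ENNReal.ofReal δ ≤
                (dcAlgorithm k c h s).toOuterMeasure {st | DetectsBothSeparately h S₁ S₂ st}) := by
  set l := h - 1 with hl
  obtain ⟨n₀, hn₀⟩ := Filter.eventually_atTop.1 (eventually_le_starCount hL (l + 1))
  -- As `2 * m ≤ n ^ 2`, the term `n₀ ^ 2` forces `n ≥ n₀`; `2 * l` makes reservoirs of size `m`
  -- large enough for two substars; `1` gives `m > 0`. None of these depends on `a`.
  refine ⟨n₀ ^ 2 + 2 * l + 1, fun a ha => ?_⟩
  have ha' : 0 < min a 1 := lt_min ha one_pos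
  obtain ⟨n₁, hn₁⟩ := Filter.eventually_atTop.1
    (eventually_blocks_le hL ha' (min_le_right a 1) l)
  set M := n₁ ^ 2 with hM
  set K : ℕ := 2 ^ B * 2 ^ (2 * M + 1) with hK
  have hK0 : 0 < K := by positivity
  refine ⟨(K : ℝ)⁻¹, by positivity, ?_⟩
  intro V₁ V₂ _ _ D G₁ G₂ F S₁ S₂ hG m hm hmm s hs k c hhk hak
  have hstars := hG.exists_isStarSystem hL l
  set n := Fintype.card V₁ with hn
  obtain ⟨⟨u₁, v₁, huv₁⟩, u₂, v₂, huv₂⟩ := hstars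
  have hmn : ∀ p : ℕ, p ^ 2 ≤ m → p ≤ n := by
    intro p hp
    have h1 := two_mul_ncard_edgeSet_le_sq G₁
    rw [hm, ← hn] at h1
    exact (Nat.pow_le_pow_iff_left two_ne_zero).1 (by omega)
  have hr : l + 1 ≤ starCount L n := hn₀ n (hmn n₀ (by omega))
  have hm₂ : G₂.edgeSet.ncard = m := by
    have h1 := (two_mul_ncard_edgeSet_eq hG.dist₁ _ (le_max_left _ (Fintype.card V₂))).1
    have h2 := (two_mul_ncard_edgeSet_eq hG.dist₂ _ (le_max_right (Fintype.card V₁) _)).1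
    omega
  set X : Finset (Sym2 (V₁ ⊕ V₂)) := (G₁ ⊕g G₂).edgeSet.toFinset with hX
  set E : Finset (Sym2 (V₁ ⊕ V₂)) :=
    @List.toFinset _ (fun a b => propDecidable (a = b)) s with hE
  have hXcard : #X = 2 * m := by
    rw [← Set.ncard_coe_finset, hX, Set.coe_toFinset, ncard_edgeSet_sum, hm, hm₂]; ring
  have hEset : (E : Set (Sym2 (V₁ ⊕ V₂))) = (joinGraph G₁ G₂ F).edgeSet := by
    ext e; exact (@List.mem_toFinset _ (fun a b => propDecidable (a = b)) s e).trans (hs.2 e)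
  have hElen : #E = s.length :=
    @List.toFinset_card_of_nodup _ (fun a b => propDecidable (a = b)) s hs.1
  have hXE : X ⊆ E := by
    rw [← coe_subset, hEset, hX, Set.coe_toFinset]
    exact SimpleGraph.edgeSet_mono le_sup_left
  have hEcard : #E ≤ 2 * m + B := by
    rw [← Set.ncard_coe_finset, hEset]
    refine (ncard_edgeSet_joinGraph_le G₁ G₂ F).trans ?_
    rw [ncard_edgeSet_sum, hm, hm₂]
    have := hG.few
    omega
  set φ₁ := starEdge (Sum.inl : V₁ → V₁ ⊕ V₂) u₁ v₁ with hφ₁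
  set φ₂ := starEdge (Sum.inr : V₂ → V₁ ⊕ V₂) u₂ v₂ with hφ₂
  have hX₁ : ∀ p, φ₁ p ∈ X := fun p => by
    rw [hX, Set.mem_toFinset, hφ₁, starEdge, SimpleGraph.mem_edgeSet]
    exact SimpleGraph.sum_adj_inl.2 (huv₁.adj _ _)
  have hX₂ : ∀ p, φ₂ p ∈ X := fun p => by
    rw [hX, Set.mem_toFinset, hφ₂, starEdge, SimpleGraph.mem_edgeSet]
    exact SimpleGraph.sum_adj_inr.2 (huv₂.adj _ _)
  have hm1 : (1 : ℝ) ≤ m := by exact_mod_cast (by omega : 1 ≤ m)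
  have hmin : min a 1 * √(m : ℝ) ≤ k :=
    (mul_le_mul_of_nonneg_right (min_le_left a 1) (Real.sqrt_nonneg _)).trans hak
  have hk0 : 0 < k := by
    have : (0 : ℝ) < k := lt_of_lt_of_le (mul_pos ha (Real.sqrt_pos.2 (by linarith))) hak
    exact_mod_cast this
  have hlB : h ≤ Fintype.card (Fin l) + 1 := by rw [Fintype.card_fin]; omega
  -- the density of the good edge sets
  have hdens : ∀ j : ℕ, 2 * l ≤ j → j ≤ m → min a 1 * √(m : ℝ) ≤ j →
      (#E).choose j ≤ K * #{T ∈ powersetCard j X | MeetsBlock φ₁ T ∧ MeetsBlock φ₂ T} := by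
    intro j hlj hjm haj
    have h1 : (#E).choose j ≤ 2 ^ B * (2 * m).choose j :=
      (Nat.choose_le_choose j hEcard).trans (choose_add_le_two_pow_mul (by omega) B)
    have h2 := choose_le_mul_card_meetsBlock (M := M) hXcard (by omega)
      (huv₁.starEdge_injective Sum.inl_injective) (huv₂.starEdge_injective Sum.inr_injective)
      hX₁ hX₂ hr hlj (by omega) (by
        intro hMm
        have h3 := two_mul_ncard_edgeSet_le hL hG.dist₁ hG.powerLaw
        rw [hm] at h3
        obtain ⟨M', h4⟩ := hn₁ n (hmn n₁ hMm) m j (by omega) h3 haj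
        exact ⟨j, M', le_rfl, h4⟩)
    rw [hK, mul_assoc]
    exact h1.trans (Nat.mul_le_mul_left _ h2)
  have hboth : ∀ st : DCState (V₁ ⊕ V₂),
      MeetsBlock φ₁ st.reservoir ∧ MeetsBlock φ₂ st.reservoir →
      st.comps = largeComponents h st.reservoir → DetectsBoth h S₁ S₂ st := by
    rintro st ⟨h1, h2⟩ hc
    obtain ⟨-, -, C₁, hC₁, -, hT₁⟩ := huv₁.exists_largeComponent Sum.inl_injective hlB h1
    obtain ⟨-, -, C₂, hC₂, -, hT₂⟩ := huv₂.exists_largeComponent Sum.inr_injective hlB h2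
    exact ⟨C₁, C₂, ⟨hc ▸ hC₁, hT₁⟩, hc ▸ hC₂, hT₂⟩
  have hsep : ∀ st : DCState (V₁ ⊕ V₂),
      st.reservoir ⊆ X ∧ MeetsBlock φ₁ st.reservoir ∧ MeetsBlock φ₂ st.reservoir →
      st.comps = largeComponents h st.reservoir → DetectsBothSeparately h S₁ S₂ st := by
    rintro st ⟨h0, h1, h2⟩ hc
    rw [← coe_subset, hX, Set.coe_toFinset] at h0
    obtain ⟨x₁, -, C₁, hC₁, hx₁, hT₁⟩ := huv₁.exists_largeComponent Sum.inl_injective hlB h1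
    obtain ⟨x₂, -, C₂, hC₂, hx₂, hT₂⟩ := huv₂.exists_largeComponent Sum.inr_injective hlB h2
    refine ⟨C₁, C₂, ⟨hc ▸ hC₁, hT₁⟩, ⟨hc ▸ hC₂, hT₂⟩, ?_, ?_⟩
    · rintro y hy
      rw [hx₁, SimpleGraph.ConnectedComponent.mem_supp_iff, SimpleGraph.ConnectedComponent.eq] at hy
      have := isLeft_eq_of_reachable h0 hy
      cases y <;> simp_all
    · rintro y hy
      rw [hx₂, SimpleGraph.ConnectedComponent.mem_supp_iff, SimpleGraph.ConnectedComponent.eq] at hy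
      have := isLeft_eq_of_reachable h0 hy
      cases y <;> simp_all
  have hseparately : k ≤ m → ENNReal.ofReal (K : ℝ)⁻¹ ≤
      (dcAlgorithm k c h s).toOuterMeasure {st | DetectsBothSeparately h S₁ S₂ st} := by
    intro hkm
    have hksl : k ≤ s.length := by
      have := card_le_card hXE
      omega
    refine le_trans ?_ ((card_div_choose_le_reservoirRun hk0 s hs.1 hksl
      (fun R => R ⊆ X ∧ MeetsBlock φ₁ R ∧ MeetsBlock φ₂ R)).trans
      (reservoirRun_le_dcAlgorithm k c h s _ _ hsep))
    refine ofReal_le_mul_inv hK0 ?_ (Nat.choose_pos hksl)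
    rw [← hElen]
    refine (hdens k (by omega) hkm hmin).trans (Nat.mul_le_mul_left _ (card_le_card ?_))
    intro T hT
    rw [mem_filter, mem_powersetCard] at hT ⊢
    exact ⟨⟨hT.1.1.trans hXE, hT.1.2⟩, hT.1.1, hT.2⟩
  refine ⟨?_, hseparately⟩
  rcases le_or_gt k m with hkm | hkm
  · refine (hseparately hkm).trans (PMF.toOuterMeasure_mono _ ?_)
    rintro st ⟨⟨C₁, C₂, h1, h2, -⟩, -⟩
    exact ⟨C₁, C₂, h1, h2⟩
  -- For `k > m` the bound `choose_add_le_two_pow_mul` need not apply, so the density is taken at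
  -- size `m` and carried up to `k` by monotonicity inside `E`. Joining edges may then enter the
  -- reservoir, hence detection without separation.
  have hd := hdens m (by omega) le_rfl (by
    have h1 : √(m : ℝ) ≤ m := Real.sqrt_le_iff.2 ⟨by linarith, by nlinarith⟩
    calc min a 1 * √(m : ℝ) ≤ 1 * √(m : ℝ) :=
          mul_le_mul_of_nonneg_right (min_le_right a 1) (Real.sqrt_nonneg _)
      _ ≤ m := by linarith)
  have hmE : m ≤ #E := by
    have := card_le_card hXE
    omega
  have hd0 : 0 < #{T ∈ powersetCard m X | MeetsBlock φ₁ T ∧ MeetsBlock φ₂ T} :=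
    Nat.pos_of_mul_pos_left (lt_of_lt_of_le (Nat.choose_pos hmE) hd)
  rcases le_or_gt k s.length with hks | hks
  · refine le_trans ?_ ((card_div_choose_le_reservoirRun hk0 s hs.1 hks
      (fun R => MeetsBlock φ₁ R ∧ MeetsBlock φ₂ R)).trans
      (reservoirRun_le_dcAlgorithm k c h s _ _ hboth))
    refine ofReal_le_mul_inv hK0 ?_ (Nat.choose_pos hks)
    rw [← hElen]
    have hmono := card_filter_powersetCard_mul_choose_le E
      (fun R => MeetsBlock φ₁ R ∧ MeetsBlock φ₂ R)
      (fun s t hst h => ⟨h.1.mono hst, h.2.mono hst⟩) hkm.le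
    have hle : #{T ∈ powersetCard m X | MeetsBlock φ₁ T ∧ MeetsBlock φ₂ T} ≤
        #{T ∈ powersetCard m E | MeetsBlock φ₁ T ∧ MeetsBlock φ₂ T} :=
      card_le_card (filter_subset_filter _ (powersetCard_mono hXE))
    refine Nat.le_of_mul_le_mul_left ?_ (hd0.trans_le hle)
    refine hmono.trans ?_
    calc _ ≤ #{T ∈ powersetCard k E | MeetsBlock φ₁ T ∧ MeetsBlock φ₂ T} *
          (K * #{T ∈ powersetCard m E | MeetsBlock φ₁ T ∧ MeetsBlock φ₂ T}) :=
          Nat.mul_le_mul_left _ (hd.trans (Nat.mul_le_mul_left _ hle))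
      _ = _ := by ring
  -- The reservoir keeps the whole stream, so the event is certain.
  · refine le_trans ?_ (reservoirRun_le_dcAlgorithm k c h s
      {R | MeetsBlock φ₁ R ∧ MeetsBlock φ₂ R} _ hboth)
    rw [reservoirRun_eq_pure k s hks.le]
    obtain ⟨T, hT⟩ := card_pos.1 hd0
    rw [mem_filter, mem_powersetCard] at hT
    have hTE : T ⊆ E := hT.1.1.trans hXE
    rw [PMF.toOuterMeasure_pure_apply, if_pos]
    · rw [ENNReal.ofReal_le_one]
      exact inv_le_one_of_one_le₀ (by exact_mod_cast hK0)
    · exact ⟨hT.2.1.mono hTE, hT.2.2.mono hTE⟩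

end
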